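/- For an integer $k \ge 1$ let $F_k$ denote the graph obtained from a cycle of length $5k-3$ (a single edge when $k=1$) by adding all chords joining vertices at distance $5j+1$ along the cycle, for $j = 0, 1, \ldots, k-1$; so $F_1$ is an edge and $F_2$ is a $7$-cycle. A graph is $\{C_3,C_5\}$-free if it contains neither a triangle nor a $5$-cycle as a (not necessarily induced) subgraph, and a graph $G$ is homomorphic to a graph $H$ if there is a map $f : V(G) \to V(H)$ such that $f(u)f(v) \in E(H)$ whenever $uv \in E(G)$. Let $k \ge 2$ be an integer, and let $G$ be a finite simple $\{C_3,C_5\}$-free graph on $n$ vertices with minimum degree $\delta(G) > \frac{k}{5k-3}\, n$. Then $G$ is homomorphic to $F_{k-1}$. -/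

import Mathlib

/-- The graph `F_k` (for `k ≥ 1`): the cycle of length `5k - 3` (a single edge when `k = 1`)
together with all chords joining vertices at distance `5j + 1` along the cycle,
`j = 0, 1, …, k - 1`; the case `j = 0` gives the cycle itself. Two vertices are adjacent
iff their difference in `ZMod (5k - 3)` is `±(5j + 1)` for such a `j`. -/
def andrasfaiF (k : ℕ) : SimpleGraph (ZMod (5 * k - 3)) :=
  SimpleGraph.circulantGraph {x | ∃ j : ℕ, j < k ∧ x = ((5 * j + 1 : ℕ) : ZMod (5 * k - 3))}

/-- A graph is `{C₃, C₅}`-free if it contains neither a triangle nor a `5`-cycle as a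
(not necessarily induced) subgraph. -/
def IsC3C5Free {V : Type*} (G : SimpleGraph V) : Prop :=
  (SimpleGraph.cycleGraph 3).Free G ∧ (SimpleGraph.cycleGraph 5).Free G

/-- `G` is homomorphic to `H` if there is an edge-preserving map `V(G) → V(H)`. -/
def IsHomomorphicTo {V W : Type*} (G : SimpleGraph V) (H : SimpleGraph W) : Prop :=
  Nonempty (G →g H)

/-! Let n be the order of G. All degrees exceed n/5, since k/(5k-3) > 1/5.

Domination. Enlarge G to an edge-maximal graph G' without closed walks of length 3 or 5; in G' any
two nonadjacent vertices are joined by a walk of length four. The core is that every closed 7-walk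
of G' is dominating (`exists_adj_of_closed_seven`). If u had no neighbour on it, then u, the walk
and some four-walks would form a small configuration. For any weighting of its vertices, averaging
over degrees yields a vertex that sees more than a fifth of the weight; iterating this leads to a
contradiction in every case. The case search is recorded in certificates with a verified checker.

Pentagon. Domination implies that the edges avoiding a neighbourhood N(u) form a bipartite graph,
and so G' maps to a 5-cycle (`exists_pentagon_coloring`).

Lifting. Call a step of G forward if the colour grows by 2, and backward otherwise. If every closed
walk of length m has at least m/(5k-8) backward steps, then a potential exists that refines the
colours to positions on a circle, and rounding these gives a map to F_{k-1}
(`isHomomorphicTo_of_nonpos`). If not, take a closed walk with the largest ratio of its length m to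
its number b of backward steps (`gain_neg` gives b > 0). The potential belonging to this ratio
places its vertices in arithmetic progression on a circle of length 5m, and the neighbours of any
vertex in an arc. So each vertex sees few terms of the walk, which contradicts the degree condition
(`gain_nonpos`). -/

namespace SimpleGraph

/-! ### Certificates for finite configurations and their checker -/

/-- Certificates refuting a finite configuration in a graph without closed walks of length
three and five whose degrees all exceed a fifth of the order. -/
inductive RefCert : Type
  /-- Vertices `i` and `j` have a common neighbour but must not have one. -/
  | bad (i j : ℕ) : RefCert
  /-- Either `i` and `j` have a common neighbour, which gets a name, or they have none. -/
  | near (i j : ℕ) (c d : RefCert) : RefCert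
  /-- Some vertex sees more than a fifth of the total weight. The vertices are grouped by their
  weights, and the list of cases follows. -/
  | wt (y : List (ℕ × List ℕ)) (c : RefCert) : RefCert
  /-- The end of a list of cases. -/
  | nil : RefCert
  /-- The case of a vertex adjacent to all of `s`, followed by the remaining cases. -/
  | cons (s : List ℕ) (c rest : RefCert) : RefCert

namespace RefCert

/-- Whether a certificate is a refutation, rather than a list of cases. -/
def IsRef : RefCert → Bool
  | nil => false
  | cons _ _ _ => false
  | _ => true

/-- The sets of vertices of the cases in a list of cases. -/
def cases : RefCert → List (List ℕ)
  | cons s _ rest => s :: rest.cases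
  | _ => []

/-- The `j`-th bit of `X`. -/
def bit (X j : ℕ) : Bool := Nat.beq (Nat.land (Nat.shiftRight X j) 1) 1

/-- The `i`-th row of a relation on `{0, …, 63}` that is packed into a natural number. -/
def row (A i : ℕ) : ℕ :=
  Nat.land (Nat.shiftRight A (Nat.mul 64 i)) 18446744073709551615

/-- Add the pair `(i, j)` to a packed symmetric relation. -/
def addPair (A i j : ℕ) : ℕ :=
  Nat.lor A (Nat.lor (Nat.shiftLeft 1 (Nat.add (Nat.mul 64 i) j))
    (Nat.shiftLeft 1 (Nat.add (Nat.mul 64 j) i)))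

/-- The union of the rows `A (j + i)`, for the bits `i` of `X`. -/
def gather (A : ℕ) : ℕ → ℕ → ℕ → ℕ
  | 0, _, _ => 0
  | k + 1, X, j => bif Nat.beq X 0 then 0 else
      bif bit X 0 then Nat.lor (row A j) (gather A k (Nat.shiftRight X 1) (Nat.succ j))
      else gather A k (Nat.shiftRight X 1) (Nat.succ j)

/-- The vertices at distance two from `i`. -/
def row₂ (A i : ℕ) : ℕ := gather A 64 (row A i) 0

/-- The vertices known to have no common neighbour with `i`. -/
def farRow (A F i : ℕ) : ℕ :=
  Nat.lor (row F i) (Nat.lor (row A i) (gather A 64 (row₂ A i) 0))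

/-- The set of the elements of a list as a bit mask. -/
def mask : List ℕ → ℕ
  | [] => 0
  | i :: s => Nat.lor (Nat.shiftLeft 1 i) (mask s)

/-- Whether some set in `br` is contained in `S`. -/
def hit (S : ℕ) : List ℕ → Bool
  | [] => false
  | b :: br => bif Nat.beq (Nat.land b S) b then true else hit S br

/-- Check that every admissible neighbourhood of weight more than a fifth of `T`
contains one of the sets in `br`. -/
def sweep (br : List ℕ) (T : ℕ) : List (ℕ × ℕ × ℕ) → ℕ → ℕ → ℕ → Bool
  | [], S, _, u => bif Nat.ble (Nat.mul 5 u) T then true else hit S br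
  | (i, a, m) :: ys, S, X, u =>
    bif Nat.ble (Nat.mul 5 u) T then true else
    bif hit S br then true else
    bif bit X i then sweep br T ys S X (Nat.sub u a) else
    bif sweep br T ys (Nat.lor S (Nat.shiftLeft 1 i)) (Nat.lor X m) u then
      sweep br T ys S X (Nat.sub u a) else false

/-- The list of the vertices with their weights. -/
def weights (y : List (ℕ × List ℕ)) : List (ℕ × ℕ) :=
  y.flatMap fun p => p.2.map fun i => (i, p.1)

/-- The checker for certificates. -/
def check : RefCert → ℕ → ℕ → ℕ → Bool
  | bad i j, _, A, F => bit (farRow A F i) j && bit (row₂ A i) j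
  | near i j c d, n, A, F =>
    Nat.blt i n && Nat.blt j n && Nat.blt n 64 && c.IsRef && d.IsRef &&
      c.check (Nat.succ n) (addPair (addPair A n i) n j) F && d.check n A (addPair F i j)
  | wt y c, n, A, F =>
    Nat.blt 0 ((weights y).map Prod.snd).sum &&
      sweep (c.cases.map mask) ((weights y).map Prod.snd).sum
        ((weights y).map fun p => (p.1, p.2, farRow A F p.1)) 0 0
        ((weights y).map Prod.snd).sum &&
      c.check n A F
  | nil, _, _, _ => true
  | cons s c rest, n, A, F =>
    s.all (fun i => Nat.blt i n) && Nat.blt n 64 && c.IsRef &&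
      c.check (Nat.succ n) (s.foldr (fun i B => addPair B n i) A) F && rest.check n A F

/-- The packed symmetric relation generated by a list of pairs. -/
def pack (E : List (ℕ × ℕ)) : ℕ := E.foldr (fun p A => addPair A p.1 p.2) 0

end RefCert

end SimpleGraph

/-! ### Averaging over degrees and soundness of the checker -/

namespace SimpleGraph

variable {V : Type*}

/-- A graph without closed walks of length three or five. -/
structure NoClosed35 (G : SimpleGraph V) : Prop where
  three : ∀ a b c, G.Adj a b → G.Adj b c → G.Adj c a → False
  five : ∀ a b c d e, G.Adj a b → G.Adj b c → G.Adj c d → G.Adj d e → G.Adj e a → False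

/-- If all degrees exceed a fifth of the order, then some vertex sees more than a fifth of
a given weight. -/
theorem exists_five_mul_sum_lt [Fintype V] {G : SimpleGraph V} [DecidableRel G.Adj]
    (hdeg : ∀ v, Fintype.card V < 5 * G.degree v) (y : List (V × ℕ))
    (hy : 0 < (y.map Prod.snd).sum) :
    ∃ z, (y.map Prod.snd).sum < 5 * (y.map fun p => if G.Adj z p.1 then p.2 else 0).sum := by
  classical
  by_contra! h
  have h1 : ∑ z, 5 * (y.map fun p => if G.Adj z p.1 then p.2 else 0).sum ≤
      Fintype.card V * (y.map Prod.snd).sum :=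
    (Finset.sum_le_card_nsmul _ _ _ fun z _ => h z).trans_eq (by simp)
  have h2 : ∀ y : List (V × ℕ),
      ∑ z, (y.map fun p => if G.Adj z p.1 then p.2 else 0).sum =
        (y.map fun p => p.2 * G.degree p.1).sum := by
    intro y
    induction y with
    | nil => simp
    | cons p y ih =>
      simp only [List.map_cons, List.sum_cons, Finset.sum_add_distrib, ih]
      congr 1
      rw [← Finset.sum_filter, Finset.sum_const, smul_eq_mul, mul_comm]
      congr 1
      rw [← card_neighborFinset_eq_degree]
      congr 1
      ext z
      simp [G.adj_comm]
  have h3 : ∀ y : List (V × ℕ), Fintype.card V * (y.map Prod.snd).sum ≤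
      5 * (y.map fun p => p.2 * G.degree p.1).sum ∧ (0 < (y.map Prod.snd).sum →
      Fintype.card V * (y.map Prod.snd).sum < 5 * (y.map fun p => p.2 * G.degree p.1).sum) := by
    intro y
    induction y with
    | nil => simp
    | cons p y ih =>
      simp only [List.map_cons, List.sum_cons]
      have h4 := hdeg p.1
      have h5 : p.2 * (Fintype.card V + 1) ≤ p.2 * (5 * G.degree p.1) :=
        Nat.mul_le_mul_left _ h4
      refine ⟨by nlinarith [ih.1], fun h => ?_⟩
      rcases Nat.eq_zero_or_pos p.2 with h0 | h0
      · rw [h0] at h ⊢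
        simpa using ih.2 (by simpa using h)
      · nlinarith [ih.1]
  rw [← Finset.mul_sum, h2] at h1
  exact absurd h1 (not_le.2 ((h3 y).2 hy))

namespace RefCert

theorem bit_iff (X j : ℕ) : bit X j = true ↔ X.testBit j = true := by
  have : bit X j = X.testBit j := by
    simp only [bit, Nat.testBit]
    change Nat.beq ((X >>> j) &&& 1) 1 = _
    rw [Nat.and_comm 1, Nat.and_one_is_mod]
    rcases Nat.mod_two_eq_zero_or_one (X >>> j) with h | h <;> rw [h] <;> rfl
  rw [this]

theorem testBit_row {A i j : ℕ} :
    (row A i).testBit j = true ↔ j < 64 ∧ A.testBit (64 * i + j) = true := by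
  change ((A >>> (64 * i)) &&& (2 ^ 64 - 1)).testBit j = true ↔ _
  rw [Nat.testBit_and, Nat.testBit_two_pow_sub_one, Nat.testBit_shiftRight, Bool.and_eq_true,
    decide_eq_true_eq, and_comm]

theorem testBit_addPair {A i j k : ℕ} : (addPair A i j).testBit k = true ↔
    A.testBit k = true ∨ 64 * i + j = k ∨ 64 * j + i = k := by
  change (A ||| ((1 <<< (64 * i + j)) ||| (1 <<< (64 * j + i)))).testBit k = true ↔ _
  simp [Nat.testBit_or, Nat.one_shiftLeft, Nat.testBit_two_pow]

theorem testBit_gather {A : ℕ} : ∀ (n X j k : ℕ), (gather A n X j).testBit k = true →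
    ∃ i, X.testBit i = true ∧ (row A (j + i)).testBit k = true
  | 0, _, _, _, h => by simp [gather] at h
  | n + 1, X, j, k, h => by
    have key : (gather A n (Nat.shiftRight X 1) (Nat.succ j)).testBit k = true →
        ∃ i, X.testBit i = true ∧ (row A (j + i)).testBit k = true := fun h => by
      obtain ⟨i, h1, h2⟩ := testBit_gather n _ _ _ h
      refine ⟨i + 1, ?_, ?_⟩
      · have h1' : (X >>> 1).testBit i = true := h1
        rw [Nat.testBit_shiftRight] at h1'
        rwa [Nat.add_comm]
      · rwa [Nat.succ_add_eq_add_succ] at h2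
    rw [gather] at h
    cases h0 : Nat.beq X 0 with
    | true => simp [h0] at h
    | false =>
      cases h1 : bit X 0 with
      | false => exact key (by simpa [h0, h1] using h)
      | true =>
        simp only [h0, h1, cond_false, cond_true] at h
        change (row A j ||| gather A n (Nat.shiftRight X 1) (Nat.succ j)).testBit k = true at h
        rw [Nat.testBit_or, Bool.or_eq_true] at h
        rcases h with h | h
        · exact ⟨0, (bit_iff _ _).1 h1, h⟩
        · exact key h

theorem testBit_mask {s : List ℕ} {i : ℕ} : (mask s).testBit i = true ↔ i ∈ s := by
  induction s with
  | nil => simp [mask]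
  | cons j s ih =>
    change ((1 <<< j) ||| mask s).testBit i = true ↔ _
    rw [Nat.testBit_or, Bool.or_eq_true, ih, Nat.one_shiftLeft, Nat.testBit_two_pow]
    simp [eq_comm]

theorem exists_of_hit {S : ℕ} : ∀ {br : List ℕ}, hit S br = true →
    ∃ b ∈ br, ∀ i, b.testBit i = true → S.testBit i = true
  | [], h => by simp [hit] at h
  | b :: br, h => by
    rw [hit] at h
    cases h0 : Nat.beq (Nat.land b S) b with
    | true =>
      refine ⟨b, by simp, fun i hi => ?_⟩
      have : b &&& S = b := Nat.eq_of_beq_eq_true h0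
      rw [← this, Nat.testBit_and, Bool.and_eq_true] at hi
      exact hi.2
    | false =>
      simp only [h0, cond_false] at h
      obtain ⟨b, hb, h⟩ := exists_of_hit h
      exact ⟨b, by simp [hb], h⟩

/-- Here `N` is the neighbourhood of some vertex, `S` holds indices already decided to lie in `N`,
`X` indices excluded from it, and `u` is the total weight minus that of the skipped vertices. A
branch closes once `u` is at most a fifth of `T` or `S` contains a listed case; the invariant is
that the actual `N` follows one of the branches. -/
theorem sweep_sound {br : List ℕ} {T : ℕ} {N : ℕ → Prop} [DecidablePred N] :
    ∀ {ys : List (ℕ × ℕ × ℕ)} {S X u : ℕ}, sweep br T ys S X u = true →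
      (∀ i, S.testBit i = true → N i) → (∀ i, X.testBit i = true → ¬ N i) →
      (∀ p ∈ ys, N p.1 → ∀ i, p.2.2.testBit i = true → ¬ N i) →
      (∃ b ∈ br, ∀ i, b.testBit i = true → N i) ∨
        5 * u ≤ T + 5 * (ys.map fun p => if N p.1 then 0 else p.2.1).sum
  | [], S, X, u, h, hS, hX, hy => by
    rw [sweep] at h
    cases h0 : Nat.ble (Nat.mul 5 u) T with
    | true => exact Or.inr (le_add_right (Nat.le_of_ble_eq_true h0))
    | false =>
      simp only [h0, cond_false] at h
      obtain ⟨b, hb, h⟩ := exists_of_hit h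
      exact Or.inl ⟨b, hb, fun i hi => hS i (h i hi)⟩
  | (i, a, m) :: ys, S, X, u, h, hS, hX, hy => by
    rw [sweep] at h
    cases h0 : Nat.ble (Nat.mul 5 u) T with
    | true => exact Or.inr (le_add_right (Nat.le_of_ble_eq_true h0))
    | false =>
    cases h1 : hit S br with
    | true =>
      obtain ⟨b, hb, h⟩ := exists_of_hit h1
      exact Or.inl ⟨b, hb, fun i hi => hS i (h i hi)⟩
    | false =>
      simp only [h0, h1, cond_false] at h
      have hy' : ∀ p ∈ ys, N p.1 → ∀ i, p.2.2.testBit i = true → ¬ N i :=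
        fun p hp => hy p (by simp [hp])
      have skip : sweep br T ys S X (Nat.sub u a) = true → ¬ N i →
          (∃ b ∈ br, ∀ i, b.testBit i = true → N i) ∨
          5 * u ≤ T + 5 * (((i, a, m) :: ys).map fun p => if N p.1 then 0 else p.2.1).sum := by
        intro h hi
        refine (sweep_sound h hS hX hy').imp_right fun h => ?_
        have h : 5 * (u - a) ≤ _ := h
        simp only [List.map_cons, hi, if_false, List.sum_cons]
        omega
      by_cases hi : N i
      · have hb : bit X i = false := by
          rw [← Bool.not_eq_true, bit_iff]
          exact fun h => hX i h hi
        simp only [hb, cond_false] at h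
        have h' : sweep br T ys (Nat.lor S (Nat.shiftLeft 1 i)) (Nat.lor X m) u = true := by
          rw [Bool.cond_eq_ite] at h
          by_contra h2
          exact Bool.false_ne_true ((if_neg h2).symm.trans h)
        refine (sweep_sound h' ?_ ?_ hy').imp_right fun h => ?_
        · intro j hj
          change (S ||| (1 <<< i)).testBit j = true at hj
          rw [Nat.testBit_or, Bool.or_eq_true, Nat.one_shiftLeft, Nat.testBit_two_pow] at hj
          rcases hj with hj | hj
          · exact hS j hj
          · rw [decide_eq_true_eq] at hj
            exact hj ▸ hi
        · intro j hj
          change (X ||| m).testBit j = true at hj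
          rw [Nat.testBit_or, Bool.or_eq_true] at hj
          exact hj.elim (hX j) (hy (i, a, m) (by simp) hi j)
        · simpa [hi] using h
      · refine skip ?_ hi
        cases h2 : bit X i with
        | true => simpa [h2] using h
        | false =>
          simp only [h2, cond_false] at h
          rw [Bool.cond_eq_ite] at h
          exact (ite_eq_iff.1 h).elim And.right fun h => absurd h.2 Bool.false_ne_true

/-- The vertices `f 0, …, f (n - 1)` realise the packed relation `A` as adjacencies, and no two
vertices related by `F` have a common neighbour. -/
structure Model (G : SimpleGraph V) (f : ℕ → V) (n A F : ℕ) : Prop where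
  adj : ∀ i j, j < 64 → A.testBit (64 * i + j) = true → i < n ∧ j < n ∧ G.Adj (f i) (f j)
  far : ∀ i j, j < 64 → F.testBit (64 * i + j) = true →
    i < n ∧ j < n ∧ ∀ z, G.Adj z (f i) → ¬ G.Adj z (f j)

namespace Model

variable {G : SimpleGraph V} {f : ℕ → V} {n A F : ℕ}

theorem row₂_sound (h : Model G f n A F) {i j : ℕ} (hj : (row₂ A i).testBit j = true) :
    ∃ z, G.Adj (f i) z ∧ G.Adj z (f j) := by
  obtain ⟨k, h1, h2⟩ := testBit_gather _ _ _ _ hj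
  rw [Nat.zero_add] at h2
  rw [testBit_row] at h1 h2
  exact ⟨f k, (h.adj _ _ h1.1 h1.2).2.2, (h.adj _ _ h2.1 h2.2).2.2⟩

/-- A common neighbour would close a triangle when the two vertices are adjacent, and a closed
5-walk when they are joined by a walk of length three. -/
theorem farRow_sound (h : Model G f n A F) (hG : G.NoClosed35) {i j : ℕ}
    (hj : (farRow A F i).testBit j = true) {z : V} (hz : G.Adj z (f i)) : ¬ G.Adj z (f j) := by
  intro hz'
  change (row F i ||| (row A i ||| gather A 64 (row₂ A i) 0)).testBit j = true at hj
  rw [Nat.testBit_or, Nat.testBit_or, Bool.or_eq_true, Bool.or_eq_true] at hj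
  rcases hj with hj | hj | hj
  · rw [testBit_row] at hj
    exact (h.far _ _ hj.1 hj.2).2.2 z hz hz'
  · rw [testBit_row] at hj
    exact hG.three _ _ _ hz (h.adj _ _ hj.1 hj.2).2.2 hz'.symm
  · obtain ⟨k, h1, h2⟩ := testBit_gather _ _ _ _ hj
    rw [Nat.zero_add, testBit_row] at h2
    obtain ⟨w, h3, h4⟩ := h.row₂_sound h1
    exact hG.five _ _ _ _ _ hz h3 h4 (h.adj _ _ h2.1 h2.2).2.2 hz'.symm

theorem update (h : Model G f n A F) (z : V) : Model G (Function.update f n z) (n + 1) A F where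
  adj i j hj ht := by
    obtain ⟨h1, h2, h3⟩ := h.adj i j hj ht
    rw [Function.update_of_ne h1.ne, Function.update_of_ne h2.ne]
    exact ⟨by omega, by omega, h3⟩
  far i j hj ht := by
    obtain ⟨h1, h2, h3⟩ := h.far i j hj ht
    rw [Function.update_of_ne h1.ne, Function.update_of_ne h2.ne]
    exact ⟨by omega, by omega, h3⟩

theorem addPair_adj (h : Model G f n A F) {i j : ℕ} (hi : i < n) (hj : j < n) (hi' : i < 64)
    (hj' : j < 64) (ha : G.Adj (f i) (f j)) : Model G f n (addPair A i j) F where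
  adj k l hl ht := by
    rw [testBit_addPair] at ht
    rcases ht with ht | ht | ht
    · exact h.adj k l hl ht
    -- The position `64 * i + j` determines the pair, because the second entries are below 64.
    · obtain ⟨rfl, rfl⟩ : i = k ∧ j = l := by omega
      exact ⟨hi, hj, ha⟩
    · obtain ⟨rfl, rfl⟩ : j = k ∧ i = l := by omega
      exact ⟨hj, hi, ha.symm⟩
  far := h.far

theorem addPair_far (h : Model G f n A F) {i j : ℕ} (hi : i < n) (hj : j < n) (hi' : i < 64)
    (hj' : j < 64) (ha : ∀ z, G.Adj z (f i) → ¬ G.Adj z (f j)) :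
    Model G f n A (addPair F i j) where
  adj := h.adj
  far k l hl ht := by
    rw [testBit_addPair] at ht
    rcases ht with ht | ht | ht
    · exact h.far k l hl ht
    · obtain ⟨rfl, rfl⟩ : i = k ∧ j = l := by omega
      exact ⟨hi, hj, ha⟩
    · obtain ⟨rfl, rfl⟩ : j = k ∧ i = l := by omega
      exact ⟨hj, hi, fun z h1 h2 => ha z h2 h1⟩

theorem foldr_addPair (h : Model G f (n + 1) A F) (hn : n < 64) {s : List ℕ}
    (hs : ∀ i ∈ s, i < n ∧ G.Adj (f n) (f i)) :
    Model G f (n + 1) (s.foldr (fun i B => addPair B n i) A) F := by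
  induction s with
  | nil => exact h
  | cons i s ih =>
    obtain ⟨h1, h2⟩ := hs i (by simp)
    exact (ih fun i hi => hs i (by simp [hi])).addPair_adj (by omega) (by omega) hn (by omega) h2

/-- A model built from lists of adjacencies and of pairs without a common neighbour. -/
theorem of_lists (hn : n ≤ 64) {E D : List (ℕ × ℕ)}
    (hE : ∀ p ∈ E, p.1 < n ∧ p.2 < n ∧ G.Adj (f p.1) (f p.2))
    (hD : ∀ p ∈ D, p.1 < n ∧ p.2 < n ∧ ∀ z, G.Adj z (f p.1) → ¬ G.Adj z (f p.2)) :
    Model G f n (pack E) (pack D) := by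
  have h0 : Model G f n 0 0 := ⟨by simp, by simp⟩
  have h1 : Model G f n (pack E) 0 := by
    induction E with
    | nil => exact h0
    | cons p E ih =>
      obtain ⟨h1, h2, h3⟩ := hE p (by simp)
      exact (ih fun p hp => hE p (by simp [hp])).addPair_adj h1 h2 (by omega) (by omega) h3
  clear hE
  induction D with
  | nil => exact h1
  | cons p D ih =>
    obtain ⟨h2, h3, h4⟩ := hD p (by simp)
    exact (ih fun p hp => hD p (by simp [hp])).addPair_far h2 h3 (by omega) (by omega) h4

end Model

/-- A checked certificate is a refutation, and a checked list of cases refutes each of them. -/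
theorem check_sound [Fintype V] {G : SimpleGraph V} [DecidableRel G.Adj] (hG : G.NoClosed35)
    (hdeg : ∀ v, Fintype.card V < 5 * G.degree v) (c : RefCert) :
    ∀ {n A F : ℕ}, c.check n A F = true → ∀ {f : ℕ → V}, Model G f n A F →
      c.IsRef = false ∧ ∀ s ∈ c.cases, ∀ z, ¬ ∀ i ∈ s, G.Adj z (f i) := by
  induction c with
  | bad i j =>
    intro n A F hc f hf
    rw [check, Bool.and_eq_true, bit_iff, bit_iff] at hc
    obtain ⟨z, h1, h2⟩ := hf.row₂_sound hc.2
    exact absurd h2 (hf.farRow_sound hG hc.1 h1.symm)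
  | near i j c d ihc ihd =>
    intro n A F hc f hf
    simp only [check, Bool.and_eq_true, Nat.blt_eq] at hc
    obtain ⟨⟨⟨⟨⟨⟨hi, hj⟩, hn⟩, h1⟩, h2⟩, h3⟩, h4⟩ := hc
    by_cases h : ∀ z, G.Adj z (f i) → ¬ G.Adj z (f j)
    · have := (ihd h4 (hf.addPair_far hi hj (by omega) (by omega) h)).1
      simp [this] at h2
    · push Not at h
      obtain ⟨z, hzi, hzj⟩ := h
      have := (ihc h3 (f := Function.update f n z) (((hf.update z).addPair_adj (i := n) (j := i)
        (by omega) (by omega) hn (by omega) (by simpa [hi.ne] using hzi)).addPair_adj (by omega)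
        (by omega) hn (by omega) (by simpa [hj.ne] using hzj))).1
      simp [this] at h1
  | wt y c ih =>
    intro n A F hc f hf
    exfalso
    simp only [check, Bool.and_eq_true, Nat.blt_eq] at hc
    obtain ⟨⟨h1, h2⟩, h3⟩ := hc
    have hs : (((weights y).map fun p => (f p.1, p.2)).map Prod.snd) =
        (weights y).map Prod.snd := by
      simp [Function.comp_def]
    obtain ⟨z, hz⟩ := exists_five_mul_sum_lt hdeg ((weights y).map fun p => (f p.1, p.2))
      (by rwa [hs])
    rw [hs, List.map_map] at hz
    rcases sweep_sound (N := fun i => G.Adj z (f i)) h2 (by simp) (by simp) (by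
        intro p hp hz i hi
        obtain ⟨q, -, rfl⟩ := List.mem_map.1 hp
        exact hf.farRow_sound hG hi hz) with ⟨b, hb, h⟩ | h
    · obtain ⟨s, hs, rfl⟩ := List.mem_map.1 hb
      exact (ih h3 hf).2 s hs z fun i hi => h i (testBit_mask.2 hi)
    -- Total weight is weight seen plus weight missed, so the bound from the sweep says that `z`
    -- sees at most a fifth, contrary to its choice.
    · have key : ∀ l : List (ℕ × ℕ), (l.map Prod.snd).sum =
          (l.map ((fun p => if G.Adj z p.1 then p.2 else 0) ∘ fun p => (f p.1, p.2))).sum +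
          ((l.map fun p => (p.1, p.2, farRow A F p.1)).map
            fun p => if G.Adj z (f p.1) then 0 else p.2.1).sum := by
        intro l
        induction l with
        | nil => simp
        | cons p l ih =>
          simp only [List.map_cons, List.sum_cons, ih, Function.comp]
          split_ifs <;> omega
      have := key (weights y)
      omega
  | nil => intros; simp [IsRef, cases]
  | cons s c rest ihc ihr =>
    intro n A F hc f hf
    simp only [check, Bool.and_eq_true, Nat.blt_eq, List.all_eq_true] at hc
    obtain ⟨⟨⟨⟨h1, hn⟩, h2⟩, h3⟩, h4⟩ := hc
    refine ⟨rfl, fun t ht z hz => ?_⟩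
    rw [cases, List.mem_cons] at ht
    rcases ht with rfl | ht
    · have := (ihc h3 (f := Function.update f n z) ((hf.update z).foldr_addPair hn
        fun i hi => ⟨h1 i hi, by simpa [(h1 i hi).ne] using hz i hi⟩)).1
      simp [this] at h2
    · exact (ihr h4 hf).2 t ht z hz

/-- A configuration with a checked refutation does not occur. -/
theorem refute [Fintype V] {G : SimpleGraph V} [DecidableRel G.Adj] (hG : G.NoClosed35)
    (hdeg : ∀ v, Fintype.card V < 5 * G.degree v) {c : RefCert} (hc : c.IsRef = true) {n : ℕ}
    {E D : List (ℕ × ℕ)} (h : c.check n (pack E) (pack D) = true) (hn : n ≤ 64) (f : ℕ → V)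
    (hE : ∀ p ∈ E, p.1 < n ∧ p.2 < n ∧ G.Adj (f p.1) (f p.2))
    (hD : ∀ p ∈ D, p.1 < n ∧ p.2 < n ∧ ∀ z, G.Adj z (f p.1) → ¬ G.Adj z (f p.2)) : False := by
  have := (check_sound hG hdeg c h (Model.of_lists hn hE hD)).1
  simp [this] at hc

end RefCert

end SimpleGraph

/-! ### The four certificates for an undominated closed 7-walk -/

namespace SimpleGraph
namespace RefCert
/-- No vertex without neighbours on a 7-cycle has a common neighbour with `x₀`, `x₂` and `x₅`. -/
def certNear025 : RefCert :=
  .near 2 15 (.near 5 12 (.near 4 14 (.wt [(2, [6]), (1, [1, 0, 2, 3, 4, 5, 7, 9, 12, 13, 14, 15,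
  16])] (.cons [1, 6, 9] (.wt [(1, [0, 2, 3, 4, 6, 9, 14, 15, 16, 19])] .nil) (.cons [3, 5, 12,
  16] (.wt [(1, [0, 4, 9, 12, 15])] .nil) .nil))) (.near 12 15 (.wt [(1, [1, 0, 2, 5, 6, 12, 15,
  17, 18, 19])] (.cons [17, 18, 19] (.wt [(1, [1, 2, 5, 6, 12, 13, 15, 16, 17, 18])] .nil) .nil))
  (.near 4 15 (.near 3 11 (.wt [(1, [0, 3, 10, 12, 15])] .nil) (.near 3 12 (.near 13 16 (.near 17
  18 (.wt [(1, [1, 2, 5, 6, 12, 13, 15, 16, 17, 18])] .nil) (.wt [(1, [1, 0, 2, 5, 6, 7, 11, 12,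
  13, 14, 15, 16, 17, 18, 21])] (.cons [11, 13, 14, 16] (.wt [(1, [1, 0, 2, 5, 6, 8, 7, 12, 13,
  14, 15, 16, 17, 18, 22])] .nil) (.cons [11, 14, 16, 17] (.wt [(2, [0, 6, 11, 12]), (1, [1, 2, 3,
  5, 8, 7, 13, 15, 16, 17, 18, 22])] .nil) (.cons [11, 13, 14, 18] (.wt [(2, [1, 0, 14, 15]), (1,
  [2, 4, 5, 6, 8, 7, 12, 13, 16, 17, 18, 22])] .nil) .nil))))) (.near 11 16 (.wt [(1, [0, 3, 6, 8,
  7, 11, 12, 13, 15, 16])] .nil) (.wt [(1, [1, 0, 6, 7, 11, 12, 13, 14, 15, 16])] (.cons [11, 13,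
  14] (.wt [(1, [1, 0, 4, 8, 7, 12, 13, 14, 15, 16])] .nil) .nil)))) (.wt [(1, [0, 3, 10, 12,
  15])] .nil))) (.wt [(1, [0, 4, 9, 12, 15])] .nil)))) (.wt [(1, [2, 5, 6, 12, 14])] (.cons [6,
  12] (.near 13 15 (.wt [(1, [0, 6, 8, 7, 11, 12, 13, 15, 16, 19])] .nil) (.near 4 12 (.wt [(1,
  [1, 2, 3, 4, 5, 7, 10, 11, 12, 13])] (.cons [10, 11, 13] (.wt [(5, [1]), (4, [2, 5]), (3, [4, 7,
  10, 11, 13]), (2, [0, 3, 6, 12, 15, 19, 20]), (1, [8, 9, 16])] .nil) .nil)) (.near 3 11 (.wt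
  [(2, [1, 2, 3, 5, 10, 11, 12]), (1, [0, 4, 6, 7, 13, 15])] (.cons [1, 6, 10] (.wt [(1, [1, 2, 3,
  4, 5, 7, 10, 11, 12, 13])] (.cons [2, 4, 13] (.wt [(1, [1, 0, 3, 4, 5, 10, 11, 12, 13, 19])]
  .nil) .nil)) (.cons [1, 6, 12] (.wt [(1, [1, 2, 3, 4, 5, 7, 10, 11, 12, 20])] .nil) (.cons [10,
  11, 13] (.wt [(2, [1, 2, 5, 11]), (1, [0, 3, 4, 6, 8, 7, 10, 12, 13, 15, 16, 20])] .nil)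
  .nil)))) (.near 4 13 (.near 15 19 (.wt [(1, [1, 0, 2, 4, 5, 6, 11, 15, 17, 19])] .nil) (.wt [(1,
  [0, 2, 3, 4, 5, 6, 8, 7, 9, 11, 12, 13, 15, 18, 19])] (.cons [0, 2, 13, 18] (.wt [(1, [2, 3, 4,
  5, 6, 7, 9, 11, 12, 18])] .nil) (.cons [3, 8, 9, 19] (.wt [(1, [4, 5, 6, 8, 7, 11, 12, 18, 19,
  20])] .nil) .nil)))) (.wt [(1, [2, 3, 4, 5, 6, 7, 9, 11, 12, 13])] .nil))))) .nil))) (.wt [(1,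
  [1, 2, 5, 11, 15])] (.cons [1, 15] (.near 12 16 (.wt [(1, [1, 0, 8, 7, 12, 13, 14, 15, 16, 18])]
  .nil) (.near 4 15 (.wt [(1, [1, 2, 4, 5, 7, 9, 10, 15, 17, 18])] (.cons [1, 9, 10] (.wt [(1, [1,
  2, 3, 4, 5, 7, 10, 14, 15, 17])] .nil) (.cons [5, 17, 18] (.wt [(1, [1, 2, 3, 4, 5, 7, 10, 14,
  15, 17])] .nil) .nil))) (.near 3 14 (.wt [(1, [1, 2, 3, 4, 5, 7, 10, 14, 15, 17])] (.cons [2, 4,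
  17] (.wt [(2, [4, 5, 14, 15]), (1, [1, 0, 2, 3, 6, 8, 7, 10, 16, 17, 18, 19])] (.cons [4, 6, 8,
  10] (.wt [(1, [1, 0, 3, 4, 5, 8, 14, 15, 17, 18])] .nil) .nil)) (.cons [4, 10, 17] (.wt [(3,
  [5]), (2, [1, 4, 14, 15, 17, 18]), (1, [0, 2, 3, 6, 8, 7, 9, 10, 16, 19])] .nil) (.cons [10, 14,
  17] (.wt [(2, [5]), (1, [1, 0, 2, 3, 4, 6, 9, 10, 14, 15, 17, 18, 19])] .nil) .nil)))) (.near 4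
  17 (.near 2 16 (.wt [(1, [2, 3, 4, 5, 6, 7, 9, 14, 15, 16])] .nil) (.near 13 14 (.near 11 18
  (.wt [(1, [2, 10, 12, 16, 18])] .nil) (.near 8 18 (.wt [(1, [2, 4, 5, 6, 8, 7, 14, 15, 16, 18])]
  .nil) (.wt [(2, [2, 6, 14]), (1, [0, 3, 4, 5, 7, 9, 15, 16, 18])] (.cons [0, 2, 7] (.wt [(1, [2,
  3, 4, 5, 6, 7, 14, 15, 16, 20])] (.cons [3, 5, 16] (.wt [(2, [2, 5, 14, 15]), (1, [1, 0, 3, 4,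
  6, 8, 7, 9, 16, 17, 18, 21])] .nil) .nil)) (.cons [9, 14, 16] (.wt [(2, [2, 5, 6, 14]), (1, [1,
  0, 3, 4, 8, 7, 9, 15, 16, 17, 18, 20])] .nil) .nil))))) (.wt [(1, [3, 6, 7, 13, 14])] .nil)))
  (.wt [(1, [2, 3, 4, 5, 6, 7, 9, 14, 15, 17])] .nil))))) .nil))

/-- Numbering: 0 to 6 are the closed walk, 7 is u, 8 to 10 are common neighbours of u with x₀, x₂,
x₅, and 11–13 and 14–16 are the inner vertices of four-walks from u to x₁ and x₆. -/
theorem check_certNear025 : certNear025.check 17 (pack [(0, 1), (1, 2), (2, 3), (3, 4), (4, 5),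
    (5, 6), (6, 0), (7, 8), (8, 0), (7, 9), (9, 2), (7, 10), (10, 5), (7, 11), (11, 12), (12, 13),
    (13, 1), (7, 14), (14, 15), (15, 16), (16, 6)]) (pack []) = true := by decide +kernel

/-- No vertex without neighbours on a 7-cycle has a common neighbour with `x₀` and `x₃` only. -/
def certNear03 : RefCert :=
  .near 1 15 (.wt [(1, [1, 0, 2, 3, 4, 5, 7, 9, 14, 15])] .nil) (.near 2 12 (.wt [(1, [1, 0, 2, 3,
  5, 6, 7, 10, 11, 12])] .nil) (.near 1 11 (.wt [(1, [2, 5, 6, 7, 11])] (.cons [5, 11] (.wt [(1,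
  [1, 0, 2, 3, 5, 6, 7, 10, 11, 18])] .nil) .nil)) (.near 4 12 (.wt [(1, [1, 0, 2, 3, 4, 5, 7, 9,
  11, 12])] .nil) (.wt [(1, [0, 3, 4, 12, 14])] (.cons [3, 12] (.wt [(1, [1, 4, 5, 7, 11])] (.cons
  [4, 11] (.near 6 14 (.wt [(1, [4, 6, 11, 12, 13, 14, 15, 16, 18, 19])] (.cons [12, 16, 18] (.wt
  [(1, [4, 5, 6, 7, 11, 12, 13, 14, 15, 16])] .nil) (.cons [13, 15, 19] (.wt [(1, [4, 5, 6, 7, 11,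
  12, 13, 14, 15, 16])] .nil) .nil))) (.near 2 11 (.near 13 15 (.wt [(1, [1, 3, 4, 5, 6, 7, 11,
  13, 14, 15])] .nil) (.wt [(1, [1, 0, 3, 4, 5, 6, 7, 11, 14, 15])] (.cons [4, 6, 15] (.wt [(1,
  [1, 0, 2, 3, 5, 6, 7, 10, 14, 15])] (.cons [2, 10, 14] (.wt [(1, [1, 0, 2, 3, 4, 5, 7, 9, 14,
  15])] .nil) .nil)) (.cons [0, 7, 15] (.wt [(1, [0, 3, 4, 6, 11, 12, 13, 15, 16, 20])] (.cons [3,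
  12, 16] (.wt [(2, [6]), (1, [0, 3, 4, 5, 7, 11, 12, 13, 14, 15, 16, 20, 21])] .nil) .nil))
  .nil)))) (.wt [(1, [1, 0, 2, 3, 4, 5, 6, 7, 11, 14])] .nil))) (.cons [5, 11] (.wt [(1, [1, 0, 2,
  3, 4, 5, 7, 9, 11, 18])] (.cons [2, 4, 18] (.wt [(1, [1, 0, 2, 3, 5, 6, 7, 10, 11, 18])] .nil)
  .nil)) .nil))) .nil)))))

/-- In this and the next two configurations 8 is a neighbour v of u, followed by the common
neighbours with the near xᵢ and then by four-walks from u to some of the remaining xᵢ. The second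
list records the xᵢ that have no common neighbour with u. -/
theorem check_certNear03 : certNear03.check 17 (pack [(0, 1), (1, 2), (2, 3), (3, 4), (4, 5), (5,
    6), (6, 0), (7, 8), (7, 9), (9, 0), (7, 10), (10, 3), (7, 11), (11, 12), (12, 13), (13, 6),
    (7, 14), (14, 15), (15, 16), (16, 4)]) (pack [(7, 1), (7, 2), (7, 4), (7, 5), (7, 6)]) = true
    := by decide +kernel

/-- No vertex without neighbours on a 7-cycle has a common neighbour with `x₀` and `x₅` only. -/
def certNear05 : RefCert :=
  .near 3 16 (.near 2 14 (.wt [(1, [0, 2, 3, 6, 7, 9, 14, 16, 20, 21])] (.cons [6, 9, 20] (.wt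
  [(1, [1, 0, 2, 3, 7, 9, 14, 15, 16, 20])] .nil) .nil)) (.near 3 14 (.near 16 19 (.near 14 19
  (.near 5 12 (.near 2 24 (.near 12 20 (.wt [(1, [1, 0, 2, 3, 5, 6, 12, 20, 24, 26])] .nil) (.near
  20 24 (.near 3 11 (.wt [(1, [1, 0, 2, 3, 4, 6, 7, 11, 12, 16])] (.cons [3, 11, 16] (.wt [(1, [1,
  0, 2, 3, 5, 6, 11, 12, 24, 28])] .nil) .nil)) (.near 11 16 (.wt [(2, [2]), (1, [1, 0, 3, 5, 6,
  7, 9, 11, 12, 14, 16, 20, 27])] (.cons [1, 3, 9, 14] (.wt [(3, [6]), (2, [0, 2, 3, 7, 11, 12,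
  16]), (1, [1, 5, 9, 14, 20, 24, 27, 28])] .nil) (.cons [2, 20, 27] (.wt [(1, [2, 3, 6, 7, 11])]
  .nil) .nil))) (.near 1 15 (.wt [(3, [1, 14]), (2, [0, 2, 7, 12, 20]), (1, [3, 4, 5, 6, 9, 11,
  15, 16, 27])] (.cons [1, 3, 12] (.wt [(3, [14]), (2, [1, 0, 2, 6, 7, 12]), (1, [3, 4, 5, 9, 11,
  15, 16, 20, 21, 27])] (.cons [4, 6, 9, 11, 20] (.wt [(2, [1, 2, 7, 14]), (1, [0, 3, 5, 6, 9, 11,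
  12, 15, 16, 20, 21, 27])] .nil) (.cons [4, 6, 15, 20, 21] (.wt [(2, [1, 2, 7, 14]), (1, [0, 3,
  4, 5, 6, 9, 11, 12, 15, 16, 21, 27])] .nil) .nil))) (.cons [1, 12, 15] (.wt [(2, [1, 2, 5, 14]),
  (1, [0, 3, 6, 7, 9, 11, 12, 15, 16, 20, 21, 28])] .nil) (.cons [2, 4, 11, 20] (.wt [(2, [1, 2,
  7, 14]), (1, [0, 3, 5, 6, 9, 11, 15, 16, 20, 21, 27, 28])] .nil) (.cons [4, 6, 9, 11, 20] (.wt
  [(1, [1, 2, 3, 5, 7, 9, 14, 15, 20, 27])] .nil) .nil))))) (.wt [(1, [1, 0, 2, 6, 7, 11, 12, 14,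
  15, 16])] (.cons [7, 12, 15] (.wt [(2, [1, 0, 2, 6, 12, 14]), (1, [3, 5, 7, 11, 15, 16, 20,
  27])] (.cons [1, 3, 12] (.wt [(3, [6]), (2, [1, 0, 2, 7, 12, 14, 16]), (1, [3, 5, 11, 15, 20,
  21, 27, 28])] (.cons [6, 15, 20, 21] (.wt [(1, [0, 2, 3, 6, 7, 9, 12, 16, 21, 27])] .nil) (.cons
  [0, 2, 21, 28] (.wt [(2, [6]), (1, [1, 0, 2, 3, 5, 7, 11, 12, 14, 15, 16, 21, 27])] .nil)
  .nil))) (.cons [1, 3, 14] (.wt [(1, [1, 5, 6, 11, 12, 13, 14, 15, 16, 28])] .nil) (.cons [3, 14,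
  16, 27] (.wt [(1, [1, 0, 2, 3, 5, 6, 11, 12, 15, 27])] .nil) .nil)))) .nil))))) (.wt [(1, [1, 0,
  2, 6, 7, 12, 14, 16, 20, 24])] .nil))) (.wt [(1, [1, 2, 7, 16, 24])] .nil)) (.wt [(1, [2, 5, 6,
  12, 14])] (.cons [6, 12] (.near 13 15 (.wt [(1, [0, 6, 7, 9, 11, 12, 13, 15, 16, 25])] .nil)
  (.near 12 15 (.near 23 24 (.near 11 19 (.wt [(1, [1, 4, 5, 7, 10, 11, 12, 19, 23, 24])] .nil)
  (.wt [(2, [7]), (1, [2, 4, 5, 6, 10, 11, 12, 14, 16, 19, 23, 24, 26])] (.cons [2, 4, 10, 11]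
  (.wt [(1, [4, 5, 6, 7, 11, 12, 14, 19, 23, 24])] .nil) .nil))) (.near 12 19 (.wt [(1, [2, 5, 6,
  7, 10, 12, 14, 19, 23, 24])] .nil) (.near 21 24 (.near 3 11 (.wt [(1, [1, 3, 4, 5, 7, 10, 11,
  12, 21, 24])] .nil) (.wt [(1, [3, 4, 5, 6, 7, 11, 12, 14, 21, 24])] (.cons [4, 6, 12] (.wt [(2,
  [7]), (1, [1, 2, 3, 4, 5, 6, 10, 11, 12, 14, 16, 21, 24])] .nil) .nil))) (.near 3 12 (.wt [(1,
  [2, 3, 5, 6, 7, 10, 12, 14, 21, 24])] .nil) (.near 18 24 (.near 4 11 (.wt [(1, [4, 5, 6, 7, 11,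
  12, 17, 18, 19, 24])] .nil) (.wt [(1, [1, 4, 5, 7, 10, 11, 12, 18, 19, 24])] .nil)) (.near 11 20
  (.wt [(1, [1, 0, 2, 3, 5, 6, 7, 9, 11, 12, 14, 20, 21, 24, 26])] (.cons [1, 3, 9, 14] (.wt [(2,
  [11]), (1, [1, 0, 3, 6, 7, 9, 12, 15, 16, 20, 24, 26, 27])] .nil) (.cons [0, 5, 7, 26] (.wt [(1,
  [1, 0, 2, 3, 6, 7, 11, 12, 14, 16, 20, 21, 24, 26, 27])] (.cons [3, 14, 16, 24] (.wt [(1, [1, 0,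
  2, 3, 11, 12, 24, 26, 27, 28])] .nil) .nil)) .nil))) (.near 13 20 (.near 3 11 (.wt [(2, [11]),
  (1, [1, 0, 2, 5, 6, 7, 9, 12, 13, 16, 20, 26, 27])] .nil) (.wt [(1, [0, 3, 11, 12, 20])] .nil))
  (.near 9 20 (.wt [(1, [1, 0, 2, 3, 7, 9, 11, 12, 16, 20])] (.cons [3, 11, 16] (.wt [(1, [1, 2,
  3, 5, 7, 9, 11, 12, 13, 20])] .nil) .nil)) (.near 2 17 (.near 16 17 (.wt [(1, [0, 2, 3, 6, 7, 9,
  16, 17, 20, 26])] .nil) (.wt [(1, [1, 4, 7, 16, 17])] .nil)) (.near 17 20 (.near 1 17 (.wt [(1,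
  [1, 5, 11, 18, 20])] .nil) (.wt [(2, [17]), (1, [1, 0, 2, 3, 4, 7, 12, 16])] .nil)) (.near 2 10
  (.wt [(2, [0, 2, 6, 7, 16, 26]), (1, [1, 3, 9, 10, 11, 14, 15, 20])] (.cons [3, 11, 14, 16] (.wt
  [(1, [1, 0, 2, 6, 7, 10, 14, 16, 26, 27])] .nil) (.cons [7, 15, 26] (.wt [(1, [0, 2, 3, 6, 7, 9,
  16, 20, 26, 27])] .nil) (.cons [3, 16, 26] (.wt [(2, [7]), (1, [1, 0, 2, 3, 6, 9, 10, 13, 14,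
  15, 16, 20, 26])] (.cons [1, 3, 9, 14] (.wt [(1, [1, 0, 2, 6, 7, 10, 14, 15, 16, 26])] .nil)
  (.cons [7, 15, 20] (.wt [(1, [1, 0, 2, 6, 7, 10, 14, 16, 20, 26])] .nil) .nil))) .nil)))) (.near
  1 10 (.near 2 11 (.wt [(2, [2, 3, 7, 10]), (1, [1, 0, 4, 5, 6, 11, 12, 14, 16, 21, 24, 27])]
  (.cons [3, 5, 16, 24] (.wt [(1, [1, 0, 2, 3, 7, 10, 11, 12, 16, 28])] .nil) (.cons [3, 14, 16,
  24] (.wt [(1, [0, 2, 3, 6, 7, 9, 11, 20, 24, 27])] .nil) (.cons [3, 5, 16, 27] (.wt [(1, [1, 0,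
  2, 3, 5, 6, 7, 10, 11, 12, 14, 21, 24, 27, 28])] .nil) .nil)))) (.wt [(1, [1, 2, 3, 5, 7, 10,
  11, 12, 13, 20])] (.cons [7, 12, 20] (.wt [(1, [1, 3, 4, 5, 10, 12, 13, 20, 26, 27])] (.cons [4,
  12, 20] (.wt [(1, [1, 2, 3, 4, 5, 7, 10, 11, 12, 13])] .nil) (.cons [5, 13, 26] (.wt [(1, [1, 2,
  3, 4, 5, 7, 10, 12, 13, 27])] .nil) .nil))) .nil))) (.wt [(1, [1, 2, 7, 10, 16])]
  .nil))))))))))))) (.wt [(1, [0, 3, 10, 12, 15])] (.cons [3, 12] (.wt [(1, [2, 3, 5, 6, 7, 10,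
  12, 14, 15, 24])] .nil) .nil)))) .nil))) (.wt [(1, [2, 6, 7, 14, 19])] .nil)) (.wt [(1, [2, 6,
  7, 16, 19])] .nil)) (.wt [(1, [2, 3, 6, 7, 14])] .nil))) (.wt [(1, [2, 3, 6, 7, 16])] (.cons [2,
  16] (.near 3 14 (.wt [(1, [2, 3, 5, 6, 7, 10, 14, 16, 20, 21])] (.cons [6, 10, 20] (.wt [(1, [2,
  3, 4, 5, 7, 10, 14, 15, 16, 20])] .nil) .nil)) (.near 2 14 (.near 12 16 (.wt [(1, [0, 3, 6, 7,
  9, 12, 13, 14, 15, 16])] .nil) (.near 13 15 (.wt [(1, [3, 6, 7, 13, 14])] .nil) (.near 13 16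
  (.near 13 14 (.near 6 18 (.near 15 19 (.wt [(1, [3, 5, 6, 7, 10, 15, 16, 17, 18, 25])] .nil)
  (.near 15 18 (.near 23 24 (.near 13 17 (.wt [(1, [1, 0, 4, 7, 9, 13, 17, 18, 23, 24])] .nil)
  (.wt [(2, [7]), (1, [1, 0, 3, 4, 6, 9, 13, 14, 16, 17, 18, 23, 24])] (.cons [1, 3, 9, 17] (.wt
  [(1, [1, 0, 6, 7, 13, 14, 17, 18, 23, 24])] .nil) .nil))) (.near 13 18 (.wt [(1, [0, 6, 7, 9,
  13, 14, 18, 23, 24, 26])] .nil) (.near 21 24 (.near 2 17 (.wt [(1, [1, 0, 2, 4, 7, 9, 17, 18,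
  21, 24])] .nil) (.wt [(1, [1, 0, 2, 6, 7, 14, 17, 18, 21, 24])] (.cons [1, 6, 18] (.wt [(2,
  [7]), (1, [1, 0, 2, 3, 4, 6, 9, 14, 16, 17, 18, 21, 24])] .nil) .nil))) (.near 2 18 (.wt [(1,
  [0, 2, 3, 6, 7, 9, 14, 18, 21, 24])] .nil) (.near 12 24 (.near 1 17 (.wt [(1, [1, 0, 6, 7, 11,
  12, 13, 17, 18, 24])] .nil) (.wt [(1, [1, 0, 4, 7, 9, 12, 13, 17, 18, 24])] .nil)) (.near 4 23
  (.near 3 9 (.wt [(2, [3, 4, 7, 14]), (1, [1, 0, 2, 5, 6, 9, 10, 16, 18, 21, 26, 27])] .nil) (.wt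
  [(1, [1, 0, 2, 3, 4, 5, 7, 9, 14, 18])] (.cons [0, 5, 7] (.wt [(1, [1, 0, 2, 3, 4, 7, 14, 18,
  26, 27])] .nil) .nil))) (.near 12 25 (.wt [(1, [1, 0, 3, 7, 10, 12, 14, 16, 18, 26])] (.cons [1,
  3, 12] (.near 4 15 (.near 1 28 (.wt [(2, [0, 14, 15]), (1, [1, 2, 3, 4, 5, 6, 7, 9, 10, 12, 16,
  21, 28, 29])] .nil) (.wt [(2, [0, 7, 12, 14, 15]), (1, [1, 2, 3, 4, 6, 9, 10, 16, 26, 28])]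
  (.cons [4, 6, 9, 10, 26] (.wt [(1, [1, 0, 2, 3, 4, 7, 9, 14, 15, 28])] .nil) (.cons [4, 6, 15,
  26] (.wt [(1, [1, 0, 4, 7, 9, 12, 13, 14, 15, 29])] .nil) .nil)))) (.wt [(1, [0, 4, 12, 15,
  17])] .nil)) .nil)) (.near 3 11 (.wt [(1, [1, 4, 7, 11, 16])] (.cons [11, 16] (.wt [(1, [2, 3,
  5, 6, 7, 10, 11, 16, 20, 26])] (.cons [6, 10, 20] (.wt [(1, [1, 2, 3, 4, 5, 7, 10, 11, 16, 27])]
  .nil) .nil)) .nil)) (.near 1 17 (.near 3 17 (.near 11 20 (.wt [(1, [1, 2, 5, 11, 18])] .nil)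
  (.near 6 11 (.wt [(1, [1, 2, 5, 6, 11, 12, 17, 18, 24, 26])] .nil) (.near 12 21 (.near 11 16
  (.near 18 29 (.near 2 11 (.near 24 31 (.wt [(2, [6, 7, 11, 24]), (1, [1, 0, 2, 3, 4, 9, 16, 17,
  18, 21, 26, 31])] .nil) (.near 23 31 (.wt [(1, [2, 3, 5, 6, 7, 10, 16, 17, 21, 27])] (.cons [3,
  5, 21] (.wt [(1, [1, 0, 2, 3, 4, 5, 6, 7, 10, 11, 17, 18, 23, 24, 26])] (.cons [2, 4, 10, 11]
  (.wt [(1, [1, 2, 5, 6, 10, 17, 18, 21, 24, 26])] .nil) (.cons [0, 5, 7, 26] (.wt [(2, [2, 5, 6,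
  17]), (1, [1, 3, 7, 11, 15, 16, 18, 21, 24, 26, 33, 34])] (.cons [2, 11, 16, 24] (.wt [(2, [2,
  5, 34, 35]), (1, [1, 3, 4, 6, 7, 11, 17, 18, 19, 24, 26, 27])] .nil) (.cons [11, 16, 17, 24]
  (.wt [(1, [2, 3, 4, 5, 16, 17, 18, 20, 26, 34])] .nil) .nil))) .nil))) (.cons [5, 7, 21] (.wt
  [(1, [1, 2, 5, 6, 17, 18, 21, 24, 26, 33])] .nil) (.cons [2, 16, 27] (.wt [(1, [3, 4, 5, 6, 7,
  11, 15, 16, 17, 27])] (.cons [4, 6, 15] (.wt [(8, [7]), (7, [3, 4, 14]), (6, [1]), (5, [5, 6,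
  10, 27]), (4, [2, 16, 17, 21, 34]), (3, [0, 18]), (2, [15]), (1, [11, 24, 26])] .nil) .nil))
  .nil)))) (.wt [(6, [23, 31]), (5, [24]), (4, [26]), (3, [2, 4, 9, 17]), (2, [1, 0, 3, 5, 6, 7,
  10, 11, 18])] .nil))) (.wt [(1, [2, 3, 6, 7, 11])] .nil)) (.wt [(1, [2, 3, 5, 6, 7, 10, 16, 17,
  18, 29])] .nil)) (.wt [(1, [3, 6, 7, 11, 16])] .nil)) (.wt [(1, [9, 12, 21, 24, 26])] .nil))))
  (.wt [(1, [2, 3, 6, 7, 17])] .nil)) (.near 16 17 (.near 20 23 (.near 3 9 (.near 5 21 (.wt [(1,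
  [1, 0, 2, 3, 4, 5, 6, 7, 9, 11, 16, 17, 18, 21, 28])] (.cons [2, 11, 16, 17] (.wt [(1, [3, 4, 5,
  6, 7, 9, 11, 16, 28, 30])] .nil) (.cons [0, 2, 16, 28] (.wt [(1, [3, 4, 5, 7, 10, 15, 16, 17,
  28, 30])] (.cons [3, 15, 30] (.wt [(1, [3, 4, 5, 6, 7, 9, 14, 15, 16, 28])] .nil) .nil)) .nil)))
  (.wt [(1, [3, 4, 5, 6, 7, 9, 14, 16, 21, 28])] .nil)) (.wt [(1, [1, 2, 3, 4, 5, 7, 9, 16, 17,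
  18])] (.cons [2, 16, 17] (.wt [(1, [1, 0, 2, 3, 4, 5, 7, 9, 17, 18])] (.cons [0, 5, 7] (.near 1
  19 (.wt [(2, [17]), (1, [1, 0, 3, 4, 5, 6, 7, 13, 18, 19, 28, 29, 30])] .nil) (.wt [(1, [1, 0,
  2, 3, 4, 7, 17, 18, 19, 29])] .nil)) .nil)) .nil))) (.wt [(1, [0, 4, 17, 20, 23])] .nil)) (.wt
  [(1, [1, 4, 7, 16, 17])] .nil))))))))))) (.wt [(1, [0, 2, 3, 5, 6, 7, 9, 14, 15, 18])] (.cons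
  [0, 5, 7] (.wt [(1, [0, 2, 3, 6, 7, 14, 15, 18, 19, 25])] .nil) .nil)))) (.wt [(1, [0, 3, 6, 14,
  18])] (.cons [0, 18] (.near 3 24 (.near 18 20 (.wt [(1, [0, 2, 3, 4, 5, 6, 18, 20, 24, 26])]
  .nil) (.near 20 24 (.near 2 17 (.wt [(2, [4, 17]), (1, [1, 0, 2, 3, 5, 6, 7, 16, 18, 19, 27])]
  (.cons [2, 16, 17] (.wt [(1, [0, 2, 3, 4, 5, 6, 17, 18, 24, 28])] .nil) (.cons [16, 17, 19] (.wt
  [(2, [0, 3, 4, 17]), (1, [2, 5, 6, 7, 10, 16, 18, 19, 20, 24, 27, 28])] .nil) .nil))) (.near 16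
  17 (.wt [(2, [3]), (1, [0, 2, 4, 5, 6, 7, 10, 14, 16, 17, 18, 20, 27])] (.cons [2, 4, 10, 14]
  (.wt [(3, [6]), (2, [2, 3, 5, 7, 16, 17, 18]), (1, [0, 4, 10, 14, 20, 24, 27, 28])] .nil) (.cons
  [3, 20, 27] (.wt [(1, [2, 3, 6, 7, 17])] .nil) .nil))) (.wt [(1, [3, 4, 5, 6, 7, 14, 15, 16, 17,
  18])] (.cons [4, 6, 15] (.wt [(2, [3, 4, 7, 14]), (1, [1, 0, 2, 5, 6, 10, 15, 16, 17, 18, 20,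
  27])] (.cons [1, 3, 17, 20] (.wt [(1, [1, 3, 4, 5, 7, 10, 14, 15, 16, 28])] .nil) (.cons [1, 6,
  10, 17, 20] (.wt [(1, [0, 2, 3, 4, 6, 7, 14, 17, 21, 27])] .nil) .nil))) (.cons [4, 15, 18] (.wt
  [(2, [0, 3, 4, 14]), (1, [2, 5, 6, 7, 10, 15, 16, 17, 18, 20, 21, 27])] .nil) (.cons [7, 15, 18]
  (.wt [(1, [0, 2, 3, 4, 5, 6, 7, 10, 14, 15, 16, 17, 18, 19, 21])] (.cons [2, 4, 10, 14] (.wt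
  [(1, [0, 4, 6, 14, 15, 16, 17, 18, 19, 28])] .nil) (.cons [7, 15, 18, 21] (.wt [(2, [2, 4, 5, 6,
  18, 28]), (1, [0, 3, 7, 16, 17, 19, 20, 21])] (.cons [2, 16, 28] (.wt [(1, [3, 4, 5, 6, 7, 16,
  17, 25, 28, 29])] .nil) .nil)) (.cons [3, 5, 19, 21] (.wt [(1, [0, 6, 14, 15, 16, 17, 18, 19,
  21, 28])] .nil) .nil)))) .nil)))))) (.wt [(1, [3, 4, 5, 6, 7, 14, 16, 18, 20, 24])] .nil))) (.wt
  [(1, [3, 4, 7, 16, 24])] .nil)) .nil))) (.wt [(1, [3, 6, 7, 13, 14])] .nil)) (.wt [(1, [3, 6, 7,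
  13, 16])] .nil)))) (.wt [(1, [2, 3, 6, 7, 14])] .nil))) .nil))

theorem check_certNear05 : certNear05.check 20 (pack [(0, 1), (1, 2), (2, 3), (3, 4), (4, 5), (5,
    6), (6, 0), (7, 8), (7, 9), (9, 0), (7, 10), (10, 5), (7, 11), (11, 12), (12, 13), (13, 1),
    (7, 14), (14, 15), (15, 16), (16, 6), (7, 17), (17, 18), (18, 19), (19, 4)]) (pack [(7, 1),
    (7, 2), (7, 3), (7, 4), (7, 6)]) = true := by decide +kernel

/-- No vertex without neighbours on a 7-cycle has a common neighbour with `x₀` only. -/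
def certNear0 : RefCert :=
  .wt [(1, [1, 2, 5, 7, 10])] (.cons [2, 10] (.near 4 11 (.wt [(1, [1, 4, 5, 7, 10])] (.cons [5,
  10] (.wt [(1, [0, 2, 3, 4, 5, 6, 7, 9, 10, 22])] (.cons [4, 6, 9] (.wt [(1, [1, 0, 2, 3, 4, 5,
  7, 9, 10, 11])] .nil) .nil)) .nil)) (.near 5 10 (.wt [(1, [0, 2, 3, 4, 5, 6, 7, 9, 10, 11])]
  (.cons [4, 6, 9] (.wt [(1, [1, 0, 2, 3, 4, 5, 7, 9, 10, 23])] .nil) .nil)) (.near 11 18 (.wt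
  [(1, [1, 5, 7, 10, 18])] .nil) (.near 4 10 (.near 10 18 (.near 3 13 (.wt [(1, [2, 5, 6, 7, 13])]
  (.cons [5, 13] (.near 13 21 (.near 22 26 (.wt [(2, [2, 5, 7, 9]), (1, [1, 0, 3, 4, 6, 10, 13,
  22, 23, 25, 26, 28])] (.cons [4, 6, 9, 10] (.wt [(2, [1, 2, 5, 7]), (1, [0, 3, 4, 6, 9, 10, 13,
  22, 25, 26, 28, 29])] .nil) (.cons [1, 3, 9, 13] (.wt [(2, [2, 5, 6, 7]), (1, [1, 0, 3, 4, 9,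
  10, 13, 22, 23, 26, 28, 29])] .nil) (.cons [9, 10, 13, 28] (.wt [(1, [0, 2, 3, 4, 5, 6, 7, 9,
  22, 28])] (.cons [4, 6, 9] (.wt [(1, [1, 0, 2, 3, 4, 5, 7, 9, 26, 28])] .nil) .nil)) .nil))))
  (.wt [(1, [1, 0, 2, 5, 6, 7, 10, 13, 22, 26])] (.cons [1, 6, 22] (.wt [(1, [0, 2, 3, 5, 6, 7, 9,
  10, 22, 26])] .nil) (.cons [1, 6, 26] (.wt [(1, [1, 0, 2, 4, 5, 7, 9, 13, 22, 26])] .nil)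
  .nil)))) (.wt [(1, [2, 6, 7, 13, 21])] .nil)) .nil)) (.wt [(1, [2, 3, 6, 7, 13])] (.cons [2, 13]
  (.near 15 22 (.wt [(1, [1, 0, 2, 5, 7, 9, 13, 14, 22, 26])] .nil) (.near 11 15 (.wt [(1, [1, 0,
  2, 5, 7, 9, 11, 13, 14, 26])] .nil) (.near 12 14 (.wt [(1, [3, 6, 7, 12, 13])] .nil) (.near 12
  13 (.near 11 25 (.near 4 26 (.wt [(1, [1, 0, 2, 3, 4, 5, 7, 9, 13, 26])] (.cons [1, 3, 9] (.wt
  [(2, [4, 7, 9]), (1, [1, 0, 2, 3, 5, 6, 10, 11, 12, 13, 23, 26, 28, 29])] .nil) .nil)) (.near 22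
  26 (.near 5 13 (.wt [(1, [1, 0, 2, 3, 4, 5, 7, 9, 13, 29])] (.cons [1, 3, 9] (.wt [(1, [0, 2, 3,
  4, 5, 6, 7, 9, 13, 25])] .nil) .nil)) (.near 13 18 (.wt [(1, [1, 4, 5, 7, 13])] (.cons [4, 13]
  (.near 14 22 (.near 12 31 (.near 11 14 (.near 15 20 (.wt [(1, [1, 4, 5, 6, 7, 13, 15, 19, 20,
  30])] (.cons [1, 6, 19] (.wt [(1, [4, 5, 6, 7, 13, 14, 15, 19, 20, 21])] .nil) .nil)) (.near 6
  19 (.wt [(1, [4, 6, 13, 14, 15, 19, 20, 21, 30, 34])] (.cons [14, 21, 30] (.wt [(1, [4, 5, 6, 7,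
  13, 14, 15, 19, 20, 21])] .nil) .nil)) (.near 3 19 (.near 15 34 (.wt [(1, [1, 4, 5, 6, 7, 13,
  15, 19, 30, 34])] .nil) (.near 5 19 (.near 22 30 (.near 14 35 (.near 22 29 (.near 18 36 (.near 1
  35 (.wt [(2, [7]), (1, [1, 0, 2, 3, 4, 5, 6, 9, 13, 15, 19, 30, 35])] (.cons [3, 5, 15, 19] (.wt
  [(2, [7]), (1, [1, 0, 2, 3, 4, 5, 6, 9, 13, 19, 22, 40, 41])] .nil) (.cons [0, 7, 30] (.wt [(3,
  [7]), (2, [1, 2, 3, 4, 19, 40]), (1, [0, 5, 6, 9, 13, 22, 30, 34, 35, 41])] .nil) .nil))) (.wt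
  [(3, [2, 5, 6, 7, 13]), (2, [0, 3, 9]), (1, [1, 4, 14, 15, 19, 22, 30, 34, 35])] (.cons [2, 4,
  13] (.wt [(1, [1, 0, 2, 5, 6, 7, 10, 19, 35, 40])] .nil) (.cons [2, 13, 15] (.wt [(3, [5, 6, 7,
  13]), (2, [0, 2, 3, 9, 34, 40]), (1, [1, 4, 15, 19, 30, 35])] (.cons [0, 7, 34] (.wt [(2, [5, 6,
  7, 13]), (1, [1, 0, 2, 3, 4, 9, 15, 19, 30, 34, 35, 40])] .nil) (.cons [4, 6, 34, 35] (.wt [(1,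
  [0, 2, 3, 5, 6, 7, 9, 13, 34, 40])] .nil) .nil))) (.cons [3, 5, 15, 19] (.wt [(1, [0, 2, 3, 6,
  7, 9, 13, 15, 22, 40])] .nil) (.cons [3, 5, 22, 30] (.wt [(1, [1, 0, 2, 5, 6, 7, 10, 19, 22,
  35])] .nil) .nil)))))) (.wt [(1, [1, 5, 7, 18, 36])] .nil)) (.wt [(1, [9, 15, 22, 29, 34])]
  .nil)) (.wt [(1, [0, 2, 3, 5, 6, 7, 9, 13, 14, 35])] .nil)) (.wt [(1, [9, 15, 22, 30, 34])]
  .nil)) (.wt [(1, [2, 5, 6, 7, 19])] .nil))) (.wt [(1, [0, 2, 3, 4, 5, 6, 7, 9, 14, 19])] (.cons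
  [4, 6, 9] (.wt [(1, [2, 3, 6, 7, 19])] (.cons [2, 19] (.wt [(1, [1, 0, 2, 3, 4, 5, 7, 9, 19,
  20])] (.cons [0, 7, 20] (.wt [(1, [0, 2, 3, 4, 5, 6, 7, 14, 19, 36])] .nil) .nil)) .nil))
  .nil))))) (.wt [(1, [0, 4, 11, 14, 19])] .nil)) (.wt [(1, [3, 6, 7, 12, 31])] .nil)) (.wt [(1,
  [0, 4, 14, 19, 22])] .nil)) .nil)) (.wt [(1, [1, 5, 7, 13, 18])] .nil))) (.wt [(1, [0, 4, 19,
  22, 26])] .nil))) (.wt [(1, [0, 4, 11, 19, 25])] .nil)) (.wt [(1, [3, 6, 7, 12, 13])] .nil)))))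
  .nil))) (.wt [(1, [1, 5, 7, 10, 18])] .nil)) (.wt [(1, [1, 4, 5, 7, 10])] .nil))))) (.cons [5,
  10] (.near 10 15 (.near 12 14 (.wt [(1, [0, 2, 5, 6, 7, 9, 10, 11, 14, 24])] .nil) (.near 2 10
  (.wt [(1, [1, 0, 2, 3, 4, 5, 7, 9, 10, 22])] (.cons [1, 3, 9] (.wt [(1, [0, 2, 3, 4, 5, 6, 7, 9,
  10, 24])] .nil) .nil)) (.wt [(1, [2, 3, 6, 7, 10])] (.cons [3, 10] (.near 21 23 (.wt [(1, [2, 6,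
  7, 10, 21])] .nil) (.near 11 21 (.wt [(1, [2, 6, 7, 10, 21])] .nil) (.near 10 21 (.near 12 17
  (.wt [(2, [1, 7, 10]), (1, [0, 2, 3, 4, 11, 12, 16, 17, 18])] (.cons [0, 7, 17] (.wt [(1, [1, 2,
  3, 7, 10, 11, 12, 17, 18, 27])] .nil) (.cons [2, 4, 16, 18] (.wt [(2, [1, 2, 7, 10]), (1, [0, 3,
  4, 5, 6, 9, 11, 12, 16, 17, 24, 27])] .nil) .nil))) (.near 1 16 (.wt [(1, [1, 3, 10, 11, 12, 16,
  17, 18, 24, 26])] (.cons [11, 18, 24] (.wt [(1, [1, 2, 3, 7, 10, 11, 12, 16, 17, 18])] .nil)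
  .nil)) (.near 4 16 (.near 12 26 (.wt [(1, [1, 2, 3, 6, 7, 10, 12, 16, 24, 26])] .nil) (.near 2
  16 (.near 11 27 (.near 14 28 (.wt [(4, [0, 7, 10, 11, 14]), (3, [2, 3, 5, 6, 9, 12, 16]), (2,
  [1, 24, 29]), (1, [4, 26, 27])] .nil) (.near 6 27 (.wt [(2, [2, 5, 7, 9]), (1, [1, 0, 3, 4, 6,
  10, 16, 22, 24, 26, 27, 29])] (.cons [2, 4, 22, 24] (.wt [(2, [7]), (1, [1, 0, 2, 3, 4, 5, 6, 9,
  10, 16, 22, 27, 29])] .nil) (.cons [0, 2, 24, 29] (.wt [(2, [5, 6, 7, 16]), (1, [0, 2, 3, 4, 9,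
  10, 22, 24, 26, 27, 29, 30])] .nil) .nil))) (.wt [(2, [1, 2, 5, 7, 10]), (1, [0, 4, 6, 9, 12,
  16, 22, 24, 26, 27])] (.cons [5, 10, 12] (.wt [(2, [1, 0, 2, 4, 5, 7, 9, 10]), (1, [3, 6, 11,
  12, 16, 24, 26, 27, 29])] (.cons [4, 6, 9, 16] (.wt [(2, [1, 2, 7, 10]), (1, [0, 3, 4, 5, 6, 9,
  12, 16, 24, 27, 29, 30])] .nil) (.cons [4, 6, 11, 24, 29] (.wt [(1, [1, 0, 2, 5, 6, 7, 10, 16,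
  24, 27])] .nil) .nil))) (.cons [2, 4, 12, 16] (.wt [(1, [1, 0, 4, 5, 7, 9, 10, 12, 22, 29])]
  .nil) (.cons [2, 4, 22, 24] (.wt [(1, [1, 0, 2, 5, 6, 7, 10, 16, 22, 27])] .nil) .nil)))))) (.wt
  [(1, [1, 0, 2, 4, 5, 7, 9, 10, 11, 27])] .nil)) (.wt [(1, [1, 2, 5, 7, 16])] .nil))) (.wt [(1,
  [1, 0, 2, 3, 4, 5, 7, 9, 11, 16])] (.cons [1, 3, 9] (.wt [(1, [1, 4, 5, 7, 16])] (.cons [5, 16]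
  (.wt [(1, [2, 3, 6, 7, 16])] (.cons [2, 16] (.wt [(1, [0, 2, 3, 4, 5, 6, 7, 9, 16, 28])] .nil)
  .nil)) .nil)) .nil))))) (.wt [(1, [2, 6, 7, 10, 21])] .nil)))) .nil)))) (.wt [(1, [1, 4, 7, 10,
  15])] .nil)) .nil))

theorem check_certNear0 : certNear0.check 22 (pack [(0, 1), (1, 2), (2, 3), (3, 4), (4, 5), (5,
    6), (6, 0), (7, 8), (7, 9), (9, 0), (7, 10), (10, 11), (11, 12), (12, 1), (7, 13), (13, 14),
    (14, 15), (15, 6), (7, 16), (16, 17), (17, 18), (18, 3), (7, 19), (19, 20), (20, 21), (21,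
    4)]) (pack [(7, 1), (7, 2), (7, 3), (7, 4), (7, 5), (7, 6)]) = true := by decide +kernel

end RefCert
end SimpleGraph

/-! ### Closed 7-walks are dominating -/

namespace SimpleGraph

variable {V : Type*}

/-- Any two nonadjacent vertices are joined by a walk of length four. -/
def FourConnected (G : SimpleGraph V) : Prop :=
  ∀ u v, ¬ G.Adj u v → ∃ a b c, G.Adj u a ∧ G.Adj a b ∧ G.Adj b c ∧ G.Adj c v

/-- `u` and `v` have a common neighbour. -/
def Near (G : SimpleGraph V) (u v : V) : Prop := ∃ z, G.Adj u z ∧ G.Adj z v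

theorem not_near_iff {G : SimpleGraph V} {u v : V} :
    ¬ G.Near u v ↔ ∀ z, G.Adj z u → ¬ G.Adj z v := by
  simp [Near, G.adj_comm u]

/-- Common neighbours of u with both ends of an edge close a walk of length five. -/
theorem not_near_of_adj {G : SimpleGraph V} (hG : G.NoClosed35) {u x y : V} (h : G.Adj x y)
    (hx : G.Near u x) :
    ¬ G.Near u y := by
  rintro ⟨z, h1, h2⟩
  obtain ⟨w, h3, h4⟩ := hx
  exact hG.five _ _ _ _ _ h3 h4 h h2.symm h1.symm

section

variable [Fintype V] {G : SimpleGraph V} [DecidableRel G.Adj]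

theorem refute_near_zero_two_five (hG : G.NoClosed35) (h4 : G.FourConnected)
    (hdeg : ∀ v, Fintype.card V < 5 * G.degree v) {x : ZMod 7 → V}
    (hx : ∀ i, G.Adj (x i) (x (i + 1))) {u : V} (hu : ∀ i, ¬ G.Adj u (x i))
    (h0 : G.Near u (x 0)) (h2 : G.Near u (x 2)) (h5 : G.Near u (x 5)) : False := by
  obtain ⟨s0, h0⟩ := h0
  obtain ⟨s2, h2⟩ := h2
  obtain ⟨s5, h5⟩ := h5
  obtain ⟨a1, b1, c1, h1⟩ := h4 _ _ (hu 1)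
  obtain ⟨a6, b6, c6, h6⟩ := h4 _ _ (hu 6)
  have e := And.intro (hx 0) <| And.intro (hx 1) <| And.intro (hx 2) <| And.intro (hx 3) <|
    And.intro (hx 4) <| And.intro (hx 5) (hx 6)
  refine RefCert.refute hG hdeg rfl RefCert.check_certNear025 (by norm_num)
    (fun i => [x 0, x 1, x 2, x 3, x 4, x 5, x 6, u, s0, s2, s5, a1, b1, c1, a6, b6, c6].getD i u)
    ?_ ?_
  · simp only [List.forall_mem_cons]
    simp [h0, h2, h5, h1, h6]
    exact e
  · simp

theorem refute_near_zero_three (hG : G.NoClosed35) (h4 : G.FourConnected)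
    (hdeg : ∀ v, Fintype.card V < 5 * G.degree v) {x : ZMod 7 → V}
    (hx : ∀ i, G.Adj (x i) (x (i + 1))) {u v : V} (hu : ∀ i, ¬ G.Adj u (x i)) (hv : G.Adj u v)
    (h0 : G.Near u (x 0)) (h3 : G.Near u (x 3))
    (hf : ∀ i, i ≠ 0 → i ≠ 3 → ¬ G.Near u (x i)) : False := by
  obtain ⟨s0, h0⟩ := h0
  obtain ⟨s3, h3⟩ := h3
  obtain ⟨a6, b6, c6, h6⟩ := h4 _ _ (hu 6)
  obtain ⟨a4, b4, c4, h4⟩ := h4 _ _ (hu 4)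
  have e := And.intro (hx 0) <| And.intro (hx 1) <| And.intro (hx 2) <| And.intro (hx 3) <|
    And.intro (hx 4) <| And.intro (hx 5) (hx 6)
  have f (i : ZMod 7) (h : i ≠ 0 ∧ i ≠ 3) := not_near_iff.1 (hf i h.1 h.2)
  refine RefCert.refute hG hdeg rfl RefCert.check_certNear03 (by norm_num)
    (fun i => [x 0, x 1, x 2, x 3, x 4, x 5, x 6, u, v, s0, s3, a6, b6, c6, a4, b4, c4].getD i u)
    ?_ ?_
  · simp only [List.forall_mem_cons]
    simp [h0, h3, h6, h4, hv]
    exact e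
  · simp only [List.forall_mem_cons]
    simp
    exact ⟨f 1 (by decide), f 2 (by decide), f 4 (by decide), f 5 (by decide), f 6 (by decide)⟩

theorem refute_near_zero_five (hG : G.NoClosed35) (h4 : G.FourConnected)
    (hdeg : ∀ v, Fintype.card V < 5 * G.degree v) {x : ZMod 7 → V}
    (hx : ∀ i, G.Adj (x i) (x (i + 1))) {u v : V} (hu : ∀ i, ¬ G.Adj u (x i)) (hv : G.Adj u v)
    (h0 : G.Near u (x 0)) (h5 : G.Near u (x 5))
    (hf : ∀ i, i ≠ 0 → i ≠ 5 → ¬ G.Near u (x i)) : False := by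
  obtain ⟨s0, h0⟩ := h0
  obtain ⟨s5, h5⟩ := h5
  obtain ⟨a1, b1, c1, h1⟩ := h4 _ _ (hu 1)
  obtain ⟨a6, b6, c6, h6⟩ := h4 _ _ (hu 6)
  obtain ⟨a4, b4, c4, h4⟩ := h4 _ _ (hu 4)
  have e := And.intro (hx 0) <| And.intro (hx 1) <| And.intro (hx 2) <| And.intro (hx 3) <|
    And.intro (hx 4) <| And.intro (hx 5) (hx 6)
  have f (i : ZMod 7) (h : i ≠ 0 ∧ i ≠ 5) := not_near_iff.1 (hf i h.1 h.2)
  refine RefCert.refute hG hdeg rfl RefCert.check_certNear05 (by norm_num)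
    (fun i => [x 0, x 1, x 2, x 3, x 4, x 5, x 6, u, v, s0, s5, a1, b1, c1, a6, b6, c6,
      a4, b4, c4].getD i u) ?_ ?_
  · simp only [List.forall_mem_cons]
    simp [h0, h5, h1, h6, h4, hv]
    exact e
  · simp only [List.forall_mem_cons]
    simp
    exact ⟨f 1 (by decide), f 2 (by decide), f 3 (by decide), f 4 (by decide), f 6 (by decide)⟩

theorem refute_near_zero (hG : G.NoClosed35) (h4 : G.FourConnected)
    (hdeg : ∀ v, Fintype.card V < 5 * G.degree v) {x : ZMod 7 → V}
    (hx : ∀ i, G.Adj (x i) (x (i + 1))) {u v : V} (hu : ∀ i, ¬ G.Adj u (x i)) (hv : G.Adj u v)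
    (h0 : G.Near u (x 0)) (hf : ∀ i, i ≠ 0 → ¬ G.Near u (x i)) : False := by
  obtain ⟨s0, h0⟩ := h0
  obtain ⟨a1, b1, c1, h1⟩ := h4 _ _ (hu 1)
  obtain ⟨a6, b6, c6, h6⟩ := h4 _ _ (hu 6)
  obtain ⟨a3, b3, c3, h3⟩ := h4 _ _ (hu 3)
  obtain ⟨a4, b4, c4, h4⟩ := h4 _ _ (hu 4)
  have e := And.intro (hx 0) <| And.intro (hx 1) <| And.intro (hx 2) <| And.intro (hx 3) <|
    And.intro (hx 4) <| And.intro (hx 5) (hx 6)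
  have f (i : ZMod 7) (h : i ≠ 0) := not_near_iff.1 (hf i h)
  refine RefCert.refute hG hdeg rfl RefCert.check_certNear0 (by norm_num)
    (fun i => [x 0, x 1, x 2, x 3, x 4, x 5, x 6, u, v, s0, a1, b1, c1, a6, b6, c6,
      a3, b3, c3, a4, b4, c4].getD i u) ?_ ?_
  · simp only [List.forall_mem_cons]
    simp [h0, h3, h1, h6, h4, hv]
    exact e
  · simp only [List.forall_mem_cons]
    simp
    exact ⟨f 1 (by decide), f 2 (by decide), f 3 (by decide), f 4 (by decide), f 5 (by decide),
      f 6 (by decide)⟩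

/-- The indices of the xᵢ near u contain no two cyclically consecutive ones. Up to rotation they are
therefore {0}, {0, 3}, {0, 5} or {0, 2, 5}, one for each certificate. -/
theorem refute_near (hG : G.NoClosed35) (h4 : G.FourConnected)
    (hdeg : ∀ v, Fintype.card V < 5 * G.degree v) {x : ZMod 7 → V}
    (hx : ∀ i, G.Adj (x i) (x (i + 1))) {u v : V} (hu : ∀ i, ¬ G.Adj u (x i)) (hv : G.Adj u v)
    (h0 : G.Near u (x 0)) : False := by
  have hrot (k i : ZMod 7) : G.Adj (x (i + k)) (x (i + 1 + k)) := by
    rw [add_right_comm]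
    exact hx _
  have n (i : ZMod 7) : G.Near u (x i) → ¬ G.Near u (x (i + 1)) := not_near_of_adj hG (hx i)
  have n1 : ¬ G.Near u (x 1) := n 0 h0
  have n6 : ¬ G.Near u (x 6) := fun h => n 6 h h0
  by_cases h2 : G.Near u (x 2)
  · have n3 : ¬ G.Near u (x 3) := n 2 h2
    by_cases h4' : G.Near u (x 4)
    · exact refute_near_zero_two_five hG h4 hdeg (hrot 2) (fun i => hu _) h2 h4' h0
    by_cases h5 : G.Near u (x 5)
    · exact refute_near_zero_two_five hG h4 hdeg hx hu h0 h2 h5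
    refine refute_near_zero_five hG h4 hdeg (hrot 2) (fun i => hu _) hv h2 h0 fun i => ?_
    fin_cases i
    exacts [fun h => absurd rfl h, fun _ _ => n3, fun _ _ => h4', fun _ _ => h5, fun _ _ => n6,
      fun _ h => absurd rfl h, fun _ _ => n1]
  by_cases h5 : G.Near u (x 5)
  · have n4 : ¬ G.Near u (x 4) := fun h => n 4 h h5
    by_cases h3 : G.Near u (x 3)
    · exact refute_near_zero_two_five hG h4 hdeg (hrot 5) (fun i => hu _) h5 h0 h3
    refine refute_near_zero_five hG h4 hdeg hx hu hv h0 h5 fun i => ?_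
    fin_cases i
    exacts [fun h => absurd rfl h, fun _ _ => n1, fun _ _ => h2, fun _ _ => h3, fun _ _ => n4,
      fun _ h => absurd rfl h, fun _ _ => n6]
  by_cases h3 : G.Near u (x 3)
  · have n4 : ¬ G.Near u (x 4) := n 3 h3
    refine refute_near_zero_three hG h4 hdeg hx hu hv h0 h3 fun i => ?_
    fin_cases i
    exacts [fun h => absurd rfl h, fun _ _ => n1, fun _ _ => h2, fun _ h => absurd rfl h,
      fun _ _ => n4, fun _ _ => h5, fun _ _ => n6]
  by_cases h4' : G.Near u (x 4)
  · refine refute_near_zero_three hG h4 hdeg (hrot 4) (fun i => hu _) hv h4' h0 fun i => ?_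
    fin_cases i
    exacts [fun h => absurd rfl h, fun _ _ => h5, fun _ _ => n6, fun _ h => absurd rfl h,
      fun _ _ => n1, fun _ _ => h2, fun _ _ => h3]
  refine refute_near_zero hG h4 hdeg hx hu hv h0 fun i => ?_
  fin_cases i
  exacts [fun h => absurd rfl h, fun _ => n1, fun _ => h2, fun _ => h3, fun _ => h4',
      fun _ => h5, fun _ => n6]

/-- Every closed walk of length seven is dominating. -/
theorem exists_adj_of_closed_seven (hG : G.NoClosed35) (h4 : G.FourConnected)
    (hdeg : ∀ v, Fintype.card V < 5 * G.degree v) {x : ZMod 7 → V}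
    (hx : ∀ i, G.Adj (x i) (x (i + 1))) (u : V) : ∃ i, G.Adj u (x i) := by
  by_contra! hu
  obtain ⟨v, hv⟩ : ∃ v, G.Adj u v := by
    rw [← G.degree_pos_iff_exists_adj]
    have := hdeg u
    omega
  by_cases hn : ∃ i, G.Near u (x i)
  · obtain ⟨i, hi⟩ := hn
    refine refute_near hG h4 hdeg (x := fun j => x (j + i)) (fun j => ?_) (fun j => hu _) hv
      (by simpa using hi)
    rw [add_right_comm]
    exact hx _
  push Not at hn
  have hz : ∃ z i, G.Adj z v ∧ G.Adj z (x i) ∧ G.Adj z (x (i + 2)) := by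
    -- The total weight is 10, so z sees weight at least 3. If z sees u, it sees nothing else, which
    -- is only 2. The xᵢ seen by z have indices pairwise at cyclic distance 2 and so number at most
    -- two; hence z sees v and two such xᵢ.
    obtain ⟨z, hz⟩ := exists_five_mul_sum_lt hdeg
      [(u, 2), (v, 1), (x 0, 1), (x 1, 1), (x 2, 1), (x 3, 1), (x 4, 1), (x 5, 1), (x 6, 1)]
      (by simp)
    have a (i : ZMod 7) : ¬ (G.Adj z (x i) ∧ G.Adj z (x (i + 1))) :=
      fun h => hG.three _ _ _ h.1 (hx i) h.2.symm
    have a' (i : ZMod 7) : ¬ (G.Adj z (x i) ∧ G.Adj z (x (i + 1 + 1 + 1))) :=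
      fun h => hG.five _ _ _ _ _ h.1 (hx i) (hx _) (hx _) h.2.symm
    have b (i : ZMod 7) : ¬ (G.Adj z u ∧ G.Adj z (x i)) := fun h => hn i ⟨z, h.1.symm, h.2⟩
    have c : ¬ (G.Adj z u ∧ G.Adj z v) := fun h => hG.three _ _ _ h.1 hv h.2.symm
    by_contra! hne
    set p : ZMod 7 → ℕ := fun i => if G.Adj z (x i) then 1 else 0 with hp
    -- The cyclic distances between i, i + 1 and i + 4 are 1, 3 and 3, each of which would close a
    -- 3-walk or a 5-walk through z.
    have t (i : ZMod 7) : p i + p (i + 1) + p (i + 1 + 1 + 1 + 1) ≤ 1 := by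
      have h1 := a i
      have h2 := a' (i + 1)
      have h3 := a' (i + 1 + 1 + 1 + 1)
      rw [show i + 1 + 1 + 1 + 1 + 1 + 1 + 1 = i by
        simp only [add_assoc]
        exact add_zero i] at h3
      simp only [hp]
      split_ifs <;> simp_all
    have t0 : p 0 + p 1 + p 4 ≤ 1 := t 0
    have t1 : p 1 + p 2 + p 5 ≤ 1 := t 1
    have t2 : p 2 + p 3 + p 6 ≤ 1 := t 2
    have t3 : p 3 + p 4 + p 0 ≤ 1 := t 3
    have t4 : p 4 + p 5 + p 1 ≤ 1 := t 4
    have t5 : p 5 + p 6 + p 2 ≤ 1 := t 5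
    have t6 : p 6 + p 0 + p 3 ≤ 1 := t 6
    simp only [List.map_cons, List.sum_cons, List.map_nil, List.sum_nil] at hz
    change _ < 5 * (_ + (_ + (p 0 + (p 1 + (p 2 + (p 3 + (p 4 + (p 5 + (p 6 + 0))))))))) at hz
    by_cases hu : G.Adj z u
    · have hb (i) : p i = 0 := if_neg fun h => b i ⟨hu, h⟩
      rw [if_pos hu, if_neg fun h => c ⟨hu, h⟩] at hz
      simp only [hb] at hz
      omega
    by_cases hv : G.Adj z v
    · have d (i : ZMod 7) : p i + p (i + 2) ≤ 1 := by
        have := hne z i hv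
        simp only [hp]
        split_ifs <;> simp_all
      have d0 : p 0 + p 2 ≤ 1 := d 0
      have d1 : p 1 + p 3 ≤ 1 := d 1
      have d2 : p 2 + p 4 ≤ 1 := d 2
      have d3 : p 3 + p 5 ≤ 1 := d 3
      have d4 : p 4 + p 6 ≤ 1 := d 4
      have d5 : p 5 + p 0 ≤ 1 := d 5
      have d6 : p 6 + p 1 ≤ 1 := d 6
      rw [if_neg hu, if_pos hv] at hz
      clear_value p
      omega
    · rw [if_neg hu, if_neg hv] at hz
      clear_value p
      omega
  obtain ⟨z, i, hzv, h1, h2⟩ := hz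
  -- Replacing the vertex between the two neighbours of z by z gives another closed 7-walk without
  -- neighbours of u. It contains z, which is near u through v.
  refine refute_near hG h4 hdeg (u := u) (v := v)
    (x := fun j => if j = 0 then z else x (j + (i + 1))) (fun j => ?_) (fun j => ?_) hv
    ⟨v, hv, by simpa using hzv.symm⟩
  · have hk (k : ZMod 7) : G.Adj (x (k + (i + 1))) (x (k + 1 + (i + 1))) := by
      rw [add_right_comm]
      exact hx _
    have e6 : (6 : ZMod 7) + (i + 1) = i := by
      rw [add_comm, add_assoc]
      exact add_zero i
    have e1 : (1 : ZMod 7) + (i + 1) = i + 2 := by ring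
    fin_cases j
    · change G.Adj z (x (1 + (i + 1)))
      rwa [e1]
    · exact hk 1
    · exact hk 2
    · exact hk 3
    · exact hk 4
    · exact hk 5
    · change G.Adj (x (6 + (i + 1))) z
      rw [e6]
      exact h1.symm
  · split_ifs
    · exact fun h => hG.three _ _ _ h hzv hv.symm
    · exact hu _

end

end SimpleGraph

/-! ### Edge-maximal graphs without closed walks of length 3 and 5 -/

namespace SimpleGraph

variable {V : Type*}

/-- A closed 5-walk that repeats a vertex contains a closed 3-walk, which is a triangle. -/
theorem noClosed35_of_isC3C5Free {G : SimpleGraph V} (h : IsC3C5Free G) : G.NoClosed35 := by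
  have h3 : ∀ a b c, G.Adj a b → G.Adj b c → G.Adj c a → False := by
    intro a b c hab hbc hca
    refine h.1 ⟨⟨⟨![a, b, c], ?_⟩, ?_⟩⟩
    · intro i j hij
      rw [cycleGraph_adj] at hij
      fin_cases i <;> fin_cases j <;> first
        | assumption
        | exact hab.symm
        | exact hbc.symm
        | exact hca.symm
        | exact absurd hij (by decide)
    · intro i j hij
      have := hab.ne
      have := hbc.ne
      have := hca.ne
      fin_cases i <;> fin_cases j <;> simp_all
  refine ⟨h3, fun a b c d e hab hbc hcd hde hea => ?_⟩
  have hac : a ≠ c := by rintro rfl; exact h3 _ _ _ hcd hde hea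
  have hbd : b ≠ d := by rintro rfl; exact h3 _ _ _ hde hea hab
  have hce : c ≠ e := by rintro rfl; exact h3 _ _ _ hea hab hbc
  have hda : d ≠ a := by rintro rfl; exact h3 _ _ _ hab hbc hcd
  have heb : e ≠ b := by rintro rfl; exact h3 _ _ _ hbc hcd hde
  refine h.2 ⟨⟨⟨![a, b, c, d, e], ?_⟩, ?_⟩⟩
  · intro i j hij
    rw [cycleGraph_adj] at hij
    fin_cases i <;> fin_cases j <;> first
      | assumption
      | exact hab.symm
      | exact hbc.symm
      | exact hcd.symm
      | exact hde.symm
      | exact hea.symm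
      | exact absurd hij (by decide)
  · intro i j hij
    have := hab.ne
    have := hbc.ne
    have := hcd.ne
    have := hde.ne
    have := hea.ne
    fin_cases i <;> fin_cases j <;> simp_all

/-- Joining two vertices that are at no distance two or four creates no short odd closed walk. -/
theorem NoClosed35.sup_edge {G : SimpleGraph V} (hG : G.NoClosed35) {u v : V} (huv : u ≠ v)
    (hadj : ¬ G.Adj u v) (h2 : ∀ a, G.Adj u a → ¬ G.Adj a v)
    (h4 : ∀ a b c, G.Adj u a → G.Adj a b → G.Adj b c → ¬ G.Adj c v) :
    (G ⊔ edge u v).NoClosed35 := by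
  have hadj' : ¬ G.Adj v u := fun h => hadj h.symm
  have h2' : ∀ a, G.Adj v a → ¬ G.Adj a u := fun a h h' => h2 a h'.symm h.symm
  have h4' : ∀ a b c, G.Adj v a → G.Adj a b → G.Adj b c → ¬ G.Adj c u :=
    fun a b c h1 h2 h3 h => h4 c b a h.symm h3.symm h2.symm h1.symm
  have key : ∀ a b, (G ⊔ edge u v).Adj a b →
      G.Adj a b ∨ (a = u ∧ b = v) ∨ (a = v ∧ b = u) := by
    intro a b h
    rw [sup_adj, edge_adj] at h
    tauto
  have h3 := hG.three
  have h5 := hG.five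
  have hirr : ∀ a, ¬ G.Adj a a := fun a => G.irrefl
  constructor
  · intro a b c hab hbc hca
    rcases key _ _ hab with h | ⟨rfl, rfl⟩ | ⟨rfl, rfl⟩ <;>
    rcases key _ _ hbc with h' | ⟨h', h''⟩ | ⟨h', h''⟩ <;>
    rcases key _ _ hca with h''' | ⟨g, g'⟩ | ⟨g, g'⟩ <;> clear key hab hbc hca <;> subst_vars <;>
    first
      | contradiction
      | exact absurd ‹_› (hirr _)
      | exact h3 _ _ _ ‹_› ‹_› ‹_›
      | exact h2 _ ‹_› ‹_›
      | exact h2' _ ‹_› ‹_›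
  -- A closed 5-walk through the new edge can be rotated and reversed so that this edge leads from u
  -- to v; this treats its other four steps.
  · have h (c d e) (p1 : (G ⊔ edge u v).Adj v c) (p2 : (G ⊔ edge u v).Adj c d)
        (p3 : (G ⊔ edge u v).Adj d e) (p4 : (G ⊔ edge u v).Adj e u) : False := by
      rcases key _ _ p1 with q1 | ⟨g1, g1'⟩ | ⟨g1, g1'⟩ <;>
      rcases key _ _ p2 with q2 | ⟨g2, g2'⟩ | ⟨g2, g2'⟩ <;>
      rcases key _ _ p3 with q3 | ⟨g3, g3'⟩ | ⟨g3, g3'⟩ <;>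
      rcases key _ _ p4 with q4 | ⟨g4, g4'⟩ | ⟨g4, g4'⟩ <;> clear key p1 p2 p3 p4 <;> subst_vars <;>
      first
        | contradiction
        | exact absurd ‹_› (hirr _)
        | exact h4' _ _ _ q1 q2 q3 q4
        | exact hG.three _ _ _ q1 q2 q3
        | exact hG.three _ _ _ q2 q3 q4
        | exact h2' _ ‹_› ‹_›
        | exact h2 _ ‹_› ‹_›
    intro a b c d e hab hbc hcd hde hea
    rcases key _ _ hab with g1 | ⟨rfl, rfl⟩ | ⟨rfl, rfl⟩
    · rcases key _ _ hbc with g2 | ⟨rfl, rfl⟩ | ⟨rfl, rfl⟩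
      · rcases key _ _ hcd with g3 | ⟨rfl, rfl⟩ | ⟨rfl, rfl⟩
        · rcases key _ _ hde with g4 | ⟨rfl, rfl⟩ | ⟨rfl, rfl⟩
          · rcases key _ _ hea with g5 | ⟨rfl, rfl⟩ | ⟨rfl, rfl⟩
            · exact h5 _ _ _ _ _ g1 g2 g3 g4 g5
            · exact h _ _ _ hab hbc hcd hde
            · exact h _ _ _ hde.symm hcd.symm hbc.symm hab.symm
          · exact h _ _ _ hea hab hbc hcd
          · exact h _ _ _ hcd.symm hbc.symm hab.symm hea.symm
        · exact h _ _ _ hde hea hab hbc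
        · exact h _ _ _ hbc.symm hab.symm hea.symm hde.symm
      · exact h _ _ _ hcd hde hea hab
      · exact h _ _ _ hab.symm hea.symm hde.symm hcd.symm
    · exact h _ _ _ hbc hcd hde hea
    · exact h _ _ _ hea.symm hde.symm hcd.symm hbc.symm

/-- In an edge-maximal graph, distinct nonadjacent u and v without a four-walk could be joined: they
have no common neighbour a either, since u, a, u, a, v would be a four-walk. For u = v, run along an
edge twice in both directions. -/
theorem NoClosed35.exists_le_fourConnected [Finite V] {G : SimpleGraph V} (hG : G.NoClosed35)
    (hne : ∀ v, ∃ w, G.Adj v w) : ∃ G', G ≤ G' ∧ G'.NoClosed35 ∧ G'.FourConnected := by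
  obtain ⟨G', hle, hmax⟩ :=
    Finite.exists_le_maximal (p := fun H : SimpleGraph V => H.NoClosed35) hG
  refine ⟨G', hle, hmax.prop, fun u v huv => ?_⟩
  by_contra! h4
  rcases eq_or_ne u v with rfl | hne'
  · obtain ⟨w, hw⟩ := hne u
    have := hle hw
    exact h4 w u w this this.symm this this.symm
  have := hmax.le_of_ge (hmax.prop.sup_edge hne' huv
    (fun a h h' => h4 a u a h h.symm h h') fun a b c h1 h2 h3 => h4 a b c h1 h2 h3) le_sup_left
  exact huv (this (by simp [edge_adj, hne']))

end SimpleGraph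

/-! ### Shortest odd closed walks and the map to the 5-cycle -/

namespace SimpleGraph

variable {V : Type*}

/-- `x` runs periodically through a shortest odd closed walk, of length `m`: a walk between two
of its vertices is no shortcut. -/
structure IsShortestOdd (H : SimpleGraph V) (m : ℕ) (x : ℕ → V) : Prop where
  odd : m % 2 = 1
  periodic : ∀ i, x (i + m) = x i
  adj : ∀ i, H.Adj (x i) (x (i + 1))
  short : ∀ i d (w : H.Walk (x (i + d)) (x i)) (e : ℕ), w.length = e → d ≤ m →
    (e % 2 = d % 2 → d ≤ e) ∧ (e % 2 ≠ d % 2 → m ≤ d + e)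

theorem exists_walk_of_adj_succ {H : SimpleGraph V} {x : ℕ → V}
    (h : ∀ i, H.Adj (x i) (x (i + 1))) (i : ℕ) :
    ∀ d, ∃ w : H.Walk (x i) (x (i + d)), w.length = d
  | 0 => ⟨.nil, rfl⟩
  | d + 1 => by
    obtain ⟨w, hw⟩ := exists_walk_of_adj_succ h i d
    exact ⟨w.concat (h (i + d)), by rw [Walk.length_concat, hw]⟩

theorem Walk.adj_getVert_mod {H : SimpleGraph V} {v : V} (w : H.Walk v v) (hw : 0 < w.length)
    (i : ℕ) : H.Adj (w.getVert (i % w.length)) (w.getVert ((i + 1) % w.length)) := by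
  have hlt : i % w.length < w.length := Nat.mod_lt _ hw
  have := w.adj_getVert_succ hlt
  rcases Nat.lt_or_ge (i % w.length + 1) w.length with h | h
  · rwa [← Nat.mod_eq_of_lt h, Nat.mod_add_mod] at this
  · have he : i % w.length + 1 = w.length := by omega
    have h0 : (i + 1) % w.length = 0 := by rw [← Nat.mod_add_mod, he, Nat.mod_self]
    rw [he, w.getVert_length] at this
    rwa [h0, w.getVert_zero]

/-- A walk between two vertices of the shortest odd closed walk closes up to an odd walk with one of
the two arcs: with the complementary arc if its parity is that of d, and with the arc of length d
otherwise. -/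
theorem exists_isShortestOdd {H : SimpleGraph V} (h : ¬ H.Colorable 2) :
    ∃ m x, H.IsShortestOdd m x := by
  classical
  rw [two_colorable_iff_forall_loop_even] at h
  push Not at h
  obtain ⟨v, w, hw⟩ := h
  rw [Nat.not_even_iff_odd] at hw
  have hex : ∃ m, ∃ (v : V) (w : H.Walk v v), Odd w.length ∧ w.length = m := ⟨_, v, w, hw, rfl⟩
  have hmin := fun k => Nat.find_min' hex (m := k)
  obtain ⟨v, w, hodd, hm⟩ := Nat.find_spec hex
  rw [← hm] at hmin
  clear hm
  set m := w.length with hm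
  rw [Nat.odd_iff] at hodd
  have hper : ∀ i, w.getVert ((i + m) % m) = w.getVert (i % m) := fun i => by
    rw [Nat.add_mod_right]
  have hadj : ∀ i, H.Adj (w.getVert (i % m)) (w.getVert ((i + 1) % m)) :=
    w.adj_getVert_mod (by omega)
  refine ⟨m, fun i => w.getVert (i % m), hodd, hper, hadj, ?_⟩
  rintro i d w' e rfl hd
  refine ⟨fun h => ?_, fun h => ?_⟩
  · obtain ⟨p, hp⟩ := exists_walk_of_adj_succ (x := fun i => w.getVert (i % m)) hadj (i + d) (m - d)
    have := hmin ((p.copy rfl (by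
      rw [show i + d + (m - d) = i + m by omega]; exact hper i)).append w'.reverse).length
      ⟨_, _, by
        rw [Walk.length_append, Walk.length_copy, Walk.length_reverse, hp, Nat.odd_iff]
        omega, rfl⟩
    rw [Walk.length_append, Walk.length_copy, Walk.length_reverse, hp] at this
    omega
  · obtain ⟨p, hp⟩ := exists_walk_of_adj_succ (x := fun i => w.getVert (i % m)) hadj i d
    have := hmin (p.append w').length
      ⟨_, _, by rw [Walk.length_append, hp, Nat.odd_iff]; omega, rfl⟩
    rwa [Walk.length_append, hp] at this

theorem IsShortestOdd.rotate {H : SimpleGraph V} {m : ℕ} {x : ℕ → V} (h : H.IsShortestOdd m x)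
    (k : ℕ) : H.IsShortestOdd m fun i => x (k + i) :=
  ⟨h.odd, fun i => by rw [← Nat.add_assoc]; exact h.periodic (k + i), fun i => h.adj (k + i),
    fun i d => by rw [← Nat.add_assoc]; exact h.short (k + i) d⟩

/-- The subgraph of the edges that avoid the neighbourhood of `u`. -/
def awayFrom (G : SimpleGraph V) (u : V) : SimpleGraph V where
  Adj a b := G.Adj a b ∧ ¬ G.Adj u a ∧ ¬ G.Adj u b
  symm := ⟨fun _ _ h => ⟨h.1.symm, h.2.2, h.2.1⟩⟩
  loopless := ⟨fun _ h => G.irrefl h.1⟩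

namespace IsShortestOdd

variable {G : SimpleGraph V} {u : V} {m : ℕ} {x : ℕ → V}

theorem not_adj (h : (G.awayFrom u).IsShortestOdd m x) (i : ℕ) : ¬ G.Adj u (x i) := (h.adj i).2.1

theorem not_adj_of_far (h : (G.awayFrom u).IsShortestOdd m x) (i : ℕ) {d : ℕ} (hd : 2 ≤ d)
    (hm : d + 2 ≤ m) : ¬ G.Adj (x (i + d)) (x i) := by
  intro ha
  have := h.short i d (.cons ⟨ha, h.not_adj _, h.not_adj _⟩ .nil) 1 rfl (by omega)
  have := h.odd
  omega

/-- A common neighbour t is not adjacent to u, because x i is not near u. So the 2-walk through t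
avoids the neighbourhood of u and would be a shortcut. -/
theorem not_near (h : (G.awayFrom u).IsShortestOdd m x) (hm : 9 ≤ m) (i : ℕ) {d : ℕ}
    (hd : 1 ≤ d ∧ d ≠ 2 ∧ d ≤ 5) (hu : ¬ G.Near u (x i)) : ¬ G.Near (x (i + d)) (x i) := by
  rintro ⟨t, h1, h2⟩
  have ht : ¬ G.Adj u t := fun ht => hu ⟨t, ht, h2⟩
  have := h.short i d (.cons (v := t) ⟨h1, h.not_adj _, ht⟩ (.cons ⟨h2, ht, h.not_adj _⟩ .nil))
    2 rfl (by omega)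
  have := h.odd
  omega

end IsShortestOdd

section

variable [Fintype V] {G : SimpleGraph V} [DecidableRel G.Adj]

theorem adj_of_closed_seven (hG : G.NoClosed35) (h4 : G.FourConnected)
    (hdeg : ∀ v, Fintype.card V < 5 * G.degree v) {a₀ a₁ a₂ a₃ a₄ a₅ a₆ : V}
    (h01 : G.Adj a₀ a₁) (h12 : G.Adj a₁ a₂) (h23 : G.Adj a₂ a₃) (h34 : G.Adj a₃ a₄)
    (h45 : G.Adj a₄ a₅) (h56 : G.Adj a₅ a₆) (h60 : G.Adj a₆ a₀) (u : V) :
    G.Adj u a₀ ∨ G.Adj u a₁ ∨ G.Adj u a₂ ∨ G.Adj u a₃ ∨ G.Adj u a₄ ∨ G.Adj u a₅ ∨ G.Adj u a₆ := by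
  let x : Fin 7 → V := ![a₀, a₁, a₂, a₃, a₄, a₅, a₆]
  obtain ⟨i, hi⟩ := exists_adj_of_closed_seven hG h4 hdeg (x := (x : ZMod 7 → V)) (fun i => by
    fin_cases i
    exacts [h01, h12, h23, h34, h45, h56, h60]) u
  fin_cases i
  exacts [Or.inl hi, Or.inr (Or.inl hi), Or.inr (Or.inr (Or.inl hi)),
    Or.inr (Or.inr (Or.inr (Or.inl hi))), Or.inr (Or.inr (Or.inr (Or.inr (Or.inl hi)))),
    Or.inr (Or.inr (Or.inr (Or.inr (Or.inr (Or.inl hi))))),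
    Or.inr (Or.inr (Or.inr (Or.inr (Or.inr (Or.inr hi)))))]

/-- Among five vertices, two have a common neighbour. -/
theorem not_pairwise_far (hdeg : ∀ v, Fintype.card V < 5 * G.degree v) {a b c d e : V}
    (hab : ¬ G.Near a b) (hac : ¬ G.Near a c) (had : ¬ G.Near a d) (hae : ¬ G.Near a e)
    (hbc : ¬ G.Near b c) (hbd : ¬ G.Near b d) (hbe : ¬ G.Near b e) (hcd : ¬ G.Near c d)
    (hce : ¬ G.Near c e) (hde : ¬ G.Near d e) : False := by
  obtain ⟨z, hz⟩ := exists_five_mul_sum_lt hdeg [(a, 1), (b, 1), (c, 1), (d, 1), (e, 1)] (by simp)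
  have key {s t : V} (h : ¬ G.Near s t) :
      (if G.Adj z s then 1 else 0) + (if G.Adj z t then 1 else 0) ≤ 1 := by
    have := not_near_iff.1 h z
    split_ifs <;> first | omega | tauto
  have := key hab
  have := key hac
  have := key had
  have := key hae
  have := key hbc
  have := key hbd
  have := key hbe
  have := key hcd
  have := key hce
  have := key hde
  simp only [List.map_cons, List.sum_cons, List.map_nil, List.sum_nil] at hz
  omega

namespace IsShortestOdd

variable {u : V} {m : ℕ} {x : ℕ → V}

/-- Otherwise u, x 0, x 1, x 4, x 5 pairwise have no common neighbour; the index differences are 1,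
3, 4 and 5, never 2. -/
theorem exists_near (h : (G.awayFrom u).IsShortestOdd m x) (hm : 9 ≤ m)
    (hdeg : ∀ v, Fintype.card V < 5 * G.degree v) : ∃ i, G.Near u (x i) := by
  by_contra! hu
  have key (i j : ℕ) (hij : i < j ∧ j ≠ i + 2 ∧ j ≤ i + 5) : ¬ G.Near (x j) (x i) := by
    obtain ⟨d, rfl⟩ : ∃ d, j = i + d := ⟨j - i, by omega⟩
    exact h.not_near hm i (by omega) (hu i)
  exact not_pairwise_far hdeg (hu 5) (hu 4) (hu 1) (hu 0) (key 4 5 (by omega)) (key 1 5 (by omega))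
    (key 0 5 (by omega)) (key 1 4 (by omega)) (key 0 4 (by omega)) (key 0 1 (by omega))

/-- A four-walk u, a, b, c, x 0 closes through x 1 and its common neighbour t with u to a 7-walk,
which dominates x 4. Adjacency of x 4 to b, c, x 0 or x 1 would be a shortcut, so x 4 is adjacent to
a or t. -/
theorem near_three (h : (G.awayFrom u).IsShortestOdd m x) (hm : 9 ≤ m) (hG : G.NoClosed35)
    (h4 : G.FourConnected) (hdeg : ∀ v, Fintype.card V < 5 * G.degree v)
    (h0 : G.Near u (x 1)) : G.Near u (x 4) := by
  by_contra hn
  have hx0 : ¬ G.Near u (x 0) := fun h0' => not_near_of_adj hG (h.adj 0).1 h0' h0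
  obtain ⟨t, ht, ht'⟩ := h0
  obtain ⟨a, b, c, hua, hab, hbc, hcx⟩ := h4 _ _ (h.not_adj 0)
  have hb : ¬ G.Adj u b := fun hb => hG.three _ _ _ hua hab hb.symm
  have hc : ¬ G.Adj u c := fun hc => hx0 ⟨c, hc, hcx⟩
  have hodd := h.odd
  rcases adj_of_closed_seven hG h4 hdeg hua hab hbc hcx (h.adj 0).1 ht'.symm ht.symm (x 4)
    with g | g | g | g | g | g | g
  · exact h.not_adj 4 g.symm
  · exact hn ⟨a, hua, g.symm⟩
  · have := h.short 0 4 (.cons (v := b) ⟨g, h.not_adj _, hb⟩ (.cons (v := c) ⟨hbc, hb, hc⟩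
      (.cons ⟨hcx, hc, h.not_adj _⟩ .nil))) 3 rfl (by omega)
    omega
  · have := h.short 0 4 (.cons (v := c) ⟨g, h.not_adj _, hc⟩
      (.cons ⟨hcx, hc, h.not_adj _⟩ .nil)) 2 rfl (by omega)
    omega
  · exact h.not_adj_of_far 0 (d := 4) (by omega) (by omega) g
  · exact h.not_adj_of_far 1 (d := 3) (by omega) (by omega) g
  · exact hn ⟨t, ht, g.symm⟩

/-- Otherwise u, x 0, x 1, x 2, x 3 and two common neighbours form a closed 7-walk. One of x 5 and x
6 is not near u, and it has no neighbour on this walk. -/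
theorem not_near_three (h : (G.awayFrom u).IsShortestOdd m x) (hm : 9 ≤ m) (hG : G.NoClosed35)
    (h4 : G.FourConnected) (hdeg : ∀ v, Fintype.card V < 5 * G.degree v)
    (h0 : G.Near u (x 0)) : ¬ G.Near u (x 3) := by
  intro h3
  obtain ⟨j, hj, hn⟩ : ∃ j, (5 ≤ j ∧ j ≤ 6) ∧ ¬ G.Near u (x j) := by
    by_cases h5 : G.Near u (x 5)
    · exact ⟨6, by omega, not_near_of_adj hG (h.adj 5).1 h5⟩
    · exact ⟨5, by omega, h5⟩
  obtain ⟨t, ht, ht'⟩ := h0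
  obtain ⟨s, hs, hs'⟩ := h3
  have key (i : ℕ) (hi : i ≤ 3) : ¬ G.Adj (x j) (x i) := by
    obtain ⟨d, rfl⟩ : ∃ d, j = i + d := ⟨j - i, by omega⟩
    exact h.not_adj_of_far i (by omega) (by omega)
  rcases adj_of_closed_seven hG h4 hdeg ht ht' (h.adj 0).1 (h.adj 1).1 (h.adj 2).1 hs'.symm hs.symm
    (x j) with g | g | g | g | g | g | g
  · exact h.not_adj j g.symm
  · exact hn ⟨t, ht, g.symm⟩
  · exact key 0 (by omega) g
  · exact key 1 (by omega) g
  · exact key 2 (by omega) g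
  · exact key 3 (by omega) g
  · exact hn ⟨s, hs, g.symm⟩

end IsShortestOdd

/-- The vertices outside a neighbourhood induce a bipartite graph. -/
theorem colorable_awayFrom (hG : G.NoClosed35) (h4 : G.FourConnected)
    (hdeg : ∀ v, Fintype.card V < 5 * G.degree v) (u : V) : (G.awayFrom u).Colorable 2 := by
  by_contra hc
  obtain ⟨m, x, h⟩ := exists_isShortestOdd hc
  have hodd := h.odd
  have hadj (i : ℕ) : G.Adj (x i) (x (i + 1)) := (h.adj i).1
  rcases Nat.lt_or_ge m 9 with hm | hm
  · have h0 : x m = x 0 := by simpa using h.periodic 0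
    obtain rfl | rfl | rfl | rfl : m = 1 ∨ m = 3 ∨ m = 5 ∨ m = 7 := by omega
    · exact G.irrefl (h0 ▸ hadj 0)
    · exact hG.three _ _ _ (hadj 0) (hadj 1) (h0 ▸ hadj 2)
    · exact hG.five _ _ _ _ _ (hadj 0) (hadj 1) (hadj 2) (hadj 3) (h0 ▸ hadj 4)
    · rcases adj_of_closed_seven hG h4 hdeg (hadj 0) (hadj 1) (hadj 2) (hadj 3) (hadj 4) (hadj 5)
        (h0 ▸ hadj 6) u with g | g | g | g | g | g | g <;> exact h.not_adj _ g
  · obtain ⟨i, hi⟩ := h.exists_near hm hdeg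
    -- Adding the period `m` makes the index before `i` available when `i = 0`.
    have h1 : G.Near u (x (i + m)) := by rwa [h.periodic]
    have h2 := (h.rotate (i + m - 1)).near_three hm hG h4 hdeg
      (by rwa [show i + m - 1 + 1 = i + m by omega])
    rw [show i + m - 1 + 4 = i + 3 + m by omega, h.periodic] at h2
    exact (h.rotate i).not_near_three hm hG h4 hdeg hi h2

/-- The graph is homomorphic to a 5-cycle, written as the colours `ZMod 5` with differences `±2`. -/
theorem exists_pentagon_coloring (hG : G.NoClosed35) (h4 : G.FourConnected)
    (hdeg : ∀ v, Fintype.card V < 5 * G.degree v) :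
    ∃ c : V → ZMod 5, ∀ a b, G.Adj a b → c b - c a = 2 ∨ c a - c b = 2 := by
  classical
  rcases isEmpty_or_nonempty V with hV | ⟨⟨u⟩⟩
  · exact ⟨0, fun a => isEmptyElim a⟩
  obtain ⟨φ⟩ := colorable_awayFrom hG h4 hdeg u
  have hφ (a b : V) (h : G.Adj a b) (ha : ¬ G.Adj u a) (hb : ¬ G.Adj u b) :
      φ a = 0 ∧ φ b = 1 ∨ φ a = 1 ∧ φ b = 0 := by
    have : φ a ≠ φ b := φ.valid ⟨h, ha, hb⟩
    omega
  -- The 5-cycle is 2, 0, 3, 1, 4. Neighbours of u get 2; the bipartition splits the vertices near u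
  -- into 0 and 4 and the remaining ones into 1 and 3.
  refine ⟨fun v => if G.Adj u v then 2 else if G.Near u v then (if φ v = 0 then 0 else 4) else
    if φ v = 0 then 1 else 3, fun a b hab => ?_⟩
  dsimp only
  by_cases ha : G.Adj u a
  · have hb : ¬ G.Adj u b := fun hb => hG.three _ _ _ ha hab hb.symm
    rw [if_pos ha, if_neg hb, if_pos ⟨a, ha, hab⟩]
    split_ifs <;> decide
  by_cases hb : G.Adj u b
  · rw [if_pos hb, if_neg ha, if_pos ⟨b, hb, hab.symm⟩]
    split_ifs <;> decide
  rw [if_neg ha, if_neg hb]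
  by_cases na : G.Near u a
  · rw [if_pos na, if_neg (not_near_of_adj hG hab na)]
    rcases hφ a b hab ha hb with ⟨h1, h2⟩ | ⟨h1, h2⟩ <;> rw [h1, h2] <;> decide
  rw [if_neg na]
  by_cases nb : G.Near u b
  · rw [if_pos nb]
    rcases hφ a b hab ha hb with ⟨h1, h2⟩ | ⟨h1, h2⟩ <;> rw [h1, h2] <;> decide
  · rw [if_neg nb]
    rcases hφ a b hab ha hb with ⟨h1, h2⟩ | ⟨h1, h2⟩ <;> rw [h1, h2] <;> decide

end

end SimpleGraph

/-! ### Gains of walks, potentials and the lift to F_{k-1} -/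

namespace SimpleGraph

variable {V : Type*} {G : SimpleGraph V}

namespace Walk

/-- The sum of the weights of the steps of a walk. -/
def gain (w : V → V → ℤ) : ∀ {u v : V}, G.Walk u v → ℤ
  | _, _, nil => 0
  | u, _, cons (v := v) _ p => w u v + p.gain w

variable {w : V → V → ℤ}

theorem gain_append {u v t : V} (p : G.Walk u v) (q : G.Walk v t) :
    (p.append q).gain w = p.gain w + q.gain w := by
  induction p with
  | nil => simp [gain]
  | cons h p ih => rw [cons_append, gain, gain, ih, add_assoc]

/-- Passing to a path cuts out closed walks that consist of one edge and a path, so their length is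
at most the order and their gain is not positive. -/
theorem gain_le_bypass [Fintype V] [DecidableEq V]
    (hw : ∀ (v : V) (p : G.Walk v v), p.length ≤ Fintype.card V → p.gain w ≤ 0) {u v : V}
    (p : G.Walk u v) : p.gain w ≤ p.bypass.gain w := by
  induction p with
  | nil => exact le_rfl
  | @cons u t v h p ih =>
    rw [bypass, gain]
    split_ifs with hs
    · have h1 := p.bypass.take_spec hs
      have h2 := congrArg (fun q => q.gain w) h1
      simp only [gain_append] at h2
      have h3 := hw u (cons h (p.bypass.takeUntil u hs)) (by
        rw [length_cons]
        exact ((p.bypass.length_takeUntil_le_length hs).trans_lt p.bypass_isPath.length_lt))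
      rw [gain] at h3
      linarith
    · rw [gain]
      linarith

theorem gain_le_mul {M : ℤ} (hM : ∀ a b, w a b ≤ M) {u v : V} (p : G.Walk u v) :
    p.gain w ≤ p.length * M := by
  induction p with
  | nil => simp [gain]
  | @cons u t v h p ih =>
    rw [gain, length_cons]
    push_cast
    linarith [hM u t]

theorem add_gain_le {Θ : V → ℤ} (h : ∀ a b, G.Adj a b → Θ a + w a b ≤ Θ b) {u v : V}
    (p : G.Walk u v) : Θ u + p.gain w ≤ Θ v := by
  induction p with
  | nil => simp [gain]
  | cons h' p ih => rw [gain]; linarith [h _ _ h']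

theorem tight_of_add_gain_eq {Θ : V → ℤ} (h : ∀ a b, G.Adj a b → Θ a + w a b ≤ Θ b) {u v : V}
    (p : G.Walk u v) (hp : Θ u + p.gain w = Θ v) {i : ℕ} (hi : i < p.length) :
    Θ (p.getVert i) + w (p.getVert i) (p.getVert (i + 1)) = Θ (p.getVert (i + 1)) := by
  induction p generalizing i with
  | nil => simp at hi
  | cons h' p ih =>
    rw [gain] at hp
    have h1 := add_gain_le h p
    have h2 := h _ _ h'
    cases i with
    | zero =>
      rw [getVert_cons_succ, getVert_zero, getVert_zero]
      linarith
    | succ i =>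
      rw [getVert_cons_succ, getVert_cons_succ]
      exact ih (by linarith) (by simpa using hi)

end Walk

/-- If no closed walk has positive gain, then some potential dominates the weights. -/
theorem exists_potential [Fintype V] {w : V → V → ℤ}
    (hw : ∀ (v : V) (p : G.Walk v v), p.length ≤ Fintype.card V → p.gain w ≤ 0) :
    ∃ Θ : V → ℤ, ∀ a b, G.Adj a b → Θ a + w a b ≤ Θ b := by
  classical
  have hM : ∃ M : ℤ, 0 ≤ M ∧ ∀ a b, w a b ≤ M := by
    refine ⟨∑ p : V × V, |w p.1 p.2|, Finset.sum_nonneg fun _ _ => abs_nonneg _, fun a b => ?_⟩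
    exact (le_abs_self _).trans (Finset.single_le_sum (f := fun p : V × V => |w p.1 p.2|)
      (fun _ _ => abs_nonneg _) (Finset.mem_univ (a, b)))
  obtain ⟨M, hM0, hM⟩ := hM
  -- The potential at v is the largest gain of a walk ending at v; it is finite because paths
  -- suffice.
  let S (v : V) : Set ℤ := {g | ∃ (u : V) (p : G.Walk u v), p.gain w = g}
  have hS (v : V) : BddAbove (S v) := by
    refine ⟨Fintype.card V * M, ?_⟩
    rintro _ ⟨u, p, rfl⟩
    refine (p.gain_le_bypass hw).trans ((p.bypass.gain_le_mul hM).trans ?_)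
    exact mul_le_mul_of_nonneg_right (by exact_mod_cast p.bypass_isPath.length_lt.le) hM0
  refine ⟨fun v => sSup (S v), fun a b hab => ?_⟩
  have : sSup (S a) ≤ sSup (S b) - w a b := by
    refine csSup_le ⟨0, a, .nil, rfl⟩ ?_
    rintro _ ⟨u, p, rfl⟩
    have := le_csSup (hS b) ⟨u, p.append (.cons hab .nil), rfl⟩
    rw [Walk.gain_append, Walk.gain, Walk.gain] at this
    linarith
  linarith

/-- Counting the terms of an arithmetic progression in an interval modulo `5 g p`. -/
theorem card_le_of_progression {g p q : ℕ} (hg : 0 < g) (hq : 0 < q) (hpq : Nat.Coprime p q)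
    (h2 : 2 * q ≤ p) (s : ℤ) {A : Finset ℕ} (hA : A ⊆ Finset.range (g * p))
    (h : ∀ j ∈ A, ∃ t : ℤ, 5 * g * q ≤ s + 5 * g * q * j + 5 * g * p * t ∧
      s + 5 * g * q * j + 5 * g * p * t ≤ 5 * g * (p - q)) :
    A.card ≤ (p - 2 * q + 1) * g := by
  have hg5 : (0 : ℤ) < 5 * g := by positivity
  -- All terms are congruent to s modulo 5g, and the ends of the interval are multiples of 5g.
  -- Division by 5g turns the condition into a condition on residues modulo p.
  set σ := s / (5 * g) with hσ
  have hs := Int.mul_ediv_add_emod s (5 * g)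
  have hs0 := Int.emod_nonneg s hg5.ne'
  have hs1 := Int.emod_lt_of_pos s hg5
  have hmem : ∀ j ∈ A, (q : ℤ) ≤ (σ + q * j) % p ∧ (σ + q * j) % p ≤ p - q := by
    intro j hj
    obtain ⟨t, h3, h4⟩ := h j hj
    have e : s + 5 * g * q * j + 5 * g * p * t = 5 * g * (σ + q * j + p * t) + s % (5 * g) := by
      linear_combination -hs
    rw [e] at h3 h4
    have h5 : (q : ℤ) < σ + q * j + p * t + 1 := by
      refine lt_of_mul_lt_mul_left (a := (5 * g : ℤ)) ?_ hg5.le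
      linarith
    have h6 : σ + q * j + p * t ≤ p - q := by
      refine le_of_mul_le_mul_left (a := (5 * g : ℤ)) ?_ hg5
      linarith
    have h7 : (σ + q * j) % p = σ + q * j + p * t := by
      rw [← Int.add_mul_emod_self_left (σ + q * j) p t]
      exact Int.emod_eq_of_lt (by omega) (by omega)
    omega
  have hp : 0 < p := by omega
  -- There are p - 2q + 1 admissible residues. By coprimality each occurs once in every block of p
  -- consecutive indices, and there are g blocks.
  have hcard := Finset.card_le_card_of_injOn (s := A)
    (t := Finset.Icc (q : ℤ) (p - q) ×ˢ Finset.range g)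
    (fun j => ((σ + q * j) % p, j / p)) (fun j hj => by
      have h1 := Finset.mem_range.1 (hA hj)
      have h2 := hmem j hj
      simp only [Finset.coe_product, Set.mem_prod, Finset.coe_Icc, Set.mem_Icc, Finset.coe_range,
        Set.mem_Iio]
      exact ⟨h2, Nat.div_lt_of_lt_mul (by rwa [mul_comm])⟩) (by
      intro i hi j hj hij
      simp only [Prod.mk.injEq] at hij
      have h1 : (p : ℤ) ∣ q * (j - i) := by
        have := Int.ModEq.dvd (n := (p : ℤ)) hij.1
        rwa [add_sub_add_left_eq_sub, ← mul_sub] at this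
      have h2 : (p : ℤ) ∣ j - i :=
        (Nat.isCoprime_iff_coprime.2 hpq).dvd_of_dvd_mul_left h1
      have h3 : i % p = j % p := by
        have := (Int.modEq_iff_dvd.2 h2 : (i : ℤ) % p = j % p)
        exact_mod_cast this
      rw [← Nat.div_add_mod i p, ← Nat.div_add_mod j p, h3, hij.2])
  refine hcard.trans ?_
  rw [Finset.card_product, Int.card_Icc, Finset.card_range]
  refine Nat.mul_le_mul_right _ ?_
  omega

/-- The weight of a step: `α` for a forward step and `-β` for a backward step. -/
def stepWeight (c : V → ZMod 5) (α β : ℤ) (a b : V) : ℤ := if c b - c a = 2 then α else -β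

/-- The gain for weights 0 and 1 is minus the number of backward steps; with the length it
determines every other gain. -/
theorem Walk.gain_stepWeight (c : V → ZMod 5) (α β : ℤ) {u v : V} (p : G.Walk u v) :
    p.gain (stepWeight c α β) = α * p.length + (α + β) * p.gain (stepWeight c 0 1) := by
  induction p with
  | nil => simp [gain]
  | cons h p ih =>
    rw [gain, gain, length_cons, ih]
    simp only [stepWeight]
    push_cast
    split_ifs <;> ring

theorem Walk.gain_stepWeight_nonpos (c : V → ZMod 5) {u v : V} (p : G.Walk u v) :
    p.gain (stepWeight c 0 1) ≤ 0 ∧ 0 ≤ p.length + p.gain (stepWeight c 0 1) := by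
  induction p with
  | nil => simp [gain]
  | cons h p ih =>
    rw [gain, length_cons]
    simp only [stepWeight]
    push_cast
    split_ifs <;> constructor <;> linarith [ih.1, ih.2]

theorem val_sub_eq_two {s t : ZMod 5} (h : t - s = 2) :
    (t.val : ℤ) = s.val + 2 ∨ (t.val : ℤ) = s.val - 3 := by
  revert s t
  decide

/-- If no closed walk has too few backward steps, the colouring lifts to a homomorphism to a
generalised Andrásfai graph. -/
theorem isHomomorphicTo_of_nonpos [Fintype V] {k : ℕ} (hk : 2 ≤ k) {c : V → ZMod 5}
    (hc : ∀ a b, G.Adj a b → c b - c a = 2 ∨ c a - c b = 2)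
    (hw : ∀ (v : V) (p : G.Walk v v), p.length ≤ Fintype.card V →
      p.gain (stepWeight c 1 (5 * k - 9)) ≤ 0) :
    IsHomomorphicTo G (andrasfaiF (k - 1)) := by
  obtain ⟨Θ, hΘ⟩ := exists_potential hw
  set N : ℤ := 5 * k - 8 with hN
  have hNcast : ((5 * (k - 1) - 3 : ℕ) : ℤ) = N := by omega
  have h22 : ∀ a b, c b - c a = 2 → c a - c b ≠ 2 := by
    intro a b
    generalize c a = s
    generalize c b = t
    revert s t
    decide
  -- `N * c + Θ` is a position on a circle of length 5N, where a forward edge advances by between 2N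
  -- + 1 = 5(2k - 3) and 3N - 1 = 5(3k - 5). After rounding to N points the advance is 2k - 3 + j
  -- with j < k - 1, and five times this is 5j + 1 modulo N.
  let y : V → ℤ := fun v => (N * (c v).val + Θ v) / 5
  have key : ∀ a b, G.Adj a b → c b - c a = 2 →
      ((5 * y a : ℤ) : ZMod (5 * (k - 1) - 3)) ≠ ((5 * y b : ℤ) : ZMod (5 * (k - 1) - 3)) ∧
      ∃ j : ℕ, j < k - 1 ∧ ((5 * y b : ℤ) : ZMod (5 * (k - 1) - 3)) -
        ((5 * y a : ℤ) : ZMod (5 * (k - 1) - 3)) = ((5 * j + 1 : ℕ) : ZMod (5 * (k - 1) - 3)) := by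
    intro a b hab h
    have h1 := hΘ a b hab
    have h2 := hΘ b a hab.symm
    rw [stepWeight, if_pos h] at h1
    rw [stepWeight, if_neg (h22 a b h)] at h2
    -- `e` records whether the colour wraps around; this shifts `y` by a multiple of N.
    obtain ⟨e, he⟩ : ∃ e : ℤ, (c b).val = (c a).val + 2 - 5 * e := by
      rcases val_sub_eq_two h with h | h
      · exact ⟨0, by linarith⟩
      · exact ⟨1, by linarith⟩
    obtain ⟨δ, hδ⟩ : ∃ δ, Θ b = Θ a + δ := ⟨Θ b - Θ a, by ring⟩
    have hyb : y b = (N * (c a).val + Θ a + (2 * N + δ)) / 5 - e * N := by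
      simp only [y]
      rw [he, hδ, show N * ((c a).val + 2 - 5 * e) + (Θ a + δ) =
        N * (c a).val + Θ a + (2 * N + δ) + -(e * N) * 5 by ring,
        Int.add_mul_ediv_right _ _ (by norm_num)]
      ring
    set A := N * (c a).val + Θ a with hA
    have hya : y a = A / 5 := rfl
    obtain ⟨j, hj⟩ : ∃ j : ℕ, (A + (2 * N + δ)) / 5 = A / 5 + (2 * k - 3) + j ∧ j < k - 1 := by
      refine ⟨((A + (2 * N + δ)) / 5 - A / 5 - (2 * k - 3)).toNat, ?_, ?_⟩ <;> omega
    have hdiff : 5 * y b - 5 * y a = ((5 * j + 1 : ℕ) : ℤ) + (2 - 5 * e) * N := by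
      rw [hyb, hya, hj.1]
      push_cast
      rw [hN]
      ring
    have hdiff' : ((5 * y b : ℤ) : ZMod (5 * (k - 1) - 3)) -
        ((5 * y a : ℤ) : ZMod (5 * (k - 1) - 3)) = ((5 * j + 1 : ℕ) : ZMod (5 * (k - 1) - 3)) := by
      rw [← Int.cast_sub, hdiff, ← hNcast]
      push_cast
      simp
    refine ⟨fun heq => ?_, j, hj.2, hdiff'⟩
    rw [heq, sub_self, eq_comm, ZMod.natCast_eq_zero_iff] at hdiff'
    have := Nat.le_of_dvd (by omega) hdiff'
    omega
  refine ⟨⟨fun v => ((5 * y v : ℤ) : ZMod (5 * (k - 1) - 3)), fun {a b} hab => ?_⟩⟩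
  rw [andrasfaiF, circulantGraph_adj]
  rcases hc a b hab with h | h
  · obtain ⟨h1, h2⟩ := key a b hab h
    exact ⟨h1, Or.inr h2⟩
  · obtain ⟨h1, h2⟩ := key b a hab.symm h
    exact ⟨h1.symm, Or.inl h2⟩

/-! ### Counting degrees along a closed walk -/

section

variable [Fintype V] [DecidableRel G.Adj] {k : ℕ}

/-- If no vertex sees more than `B` of the terms of a sequence of length `m`, then `B` is a
corresponding fraction of `m`. -/
theorem mul_lt_of_card_le
    (hdeg : ∀ v, k * Fintype.card V < (5 * k - 3) * G.degree v) {m : ℕ} (hm : 0 < m) (x : ℕ → V)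
    {B : ℕ} (hB : ∀ z, ((Finset.range m).filter fun j => G.Adj z (x j)).card ≤ B) :
    k * m < (5 * k - 3) * B := by
  classical
  have h1 : ∑ j ∈ Finset.range m, G.degree (x j) =
      ∑ z, ((Finset.range m).filter fun j => G.Adj z (x j)).card := by
    simp only [Finset.card_filter]
    rw [Finset.sum_comm]
    refine Finset.sum_congr rfl fun j _ => ?_
    rw [← card_neighborFinset_eq_degree, ← Finset.card_filter]
    congr 1
    ext z
    simp [G.adj_comm]
  have h2 : ∑ j ∈ Finset.range m, G.degree (x j) ≤ Fintype.card V * B := by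
    rw [h1]
    exact (Finset.sum_le_card_nsmul _ _ _ fun z _ => hB z).trans_eq (by simp)
  have h3 : m * (k * Fintype.card V) < (5 * k - 3) * ∑ j ∈ Finset.range m, G.degree (x j) := by
    rw [Finset.mul_sum]
    have := Finset.sum_lt_sum_of_nonempty (s := Finset.range m) ⟨0, Finset.mem_range.2 hm⟩
      fun j _ => hdeg (x j)
    simpa using this
  have h4 : Fintype.card V * (k * m) < Fintype.card V * ((5 * k - 3) * B) := by
    calc Fintype.card V * (k * m) = m * (k * Fintype.card V) := by ring
      _ < _ := h3
      _ ≤ (5 * k - 3) * (Fintype.card V * B) := Nat.mul_le_mul_left _ h2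
      _ = _ := by ring
  exact Nat.lt_of_mul_lt_mul_left h4

/-- A closed walk has a backward step. -/
theorem gain_neg (hG : G.NoClosed35) (hk : 2 ≤ k)
    (hdeg : ∀ v, k * Fintype.card V < (5 * k - 3) * G.degree v) {c : V → ZMod 5}
    (hc : ∀ a b, G.Adj a b → c b - c a = 2 ∨ c a - c b = 2) {v : V} (p : G.Walk v v)
    (hp : 0 < p.length) : p.gain (stepWeight c 0 1) < 0 := by
  by_contra hneg
  have h0 : p.gain (stepWeight c 0 1) = 0 :=
    le_antisymm (p.gain_stepWeight_nonpos c).1 (not_lt.1 hneg)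
  set m := p.length with hm
  have hstep : ∀ i < m, c (p.getVert (i + 1)) = c (p.getVert i) + 2 := by
    intro i hi
    have := p.tight_of_add_gain_eq (w := stepWeight c 0 1) (Θ := 0) (fun a b _ => by
      simp only [stepWeight]
      split_ifs <;> simp) (by simpa using h0) hi
    simp only [stepWeight] at this
    split_ifs at this with h
    · rw [← h]
      ring
    · simp at this
  have hcol : ∀ i ≤ m, c (p.getVert i) = c v + 2 * i := by
    intro i
    induction i with
    | zero => simp
    | succ i ih =>
      intro hi
      rw [hstep i hi, ih (by omega)]
      push_cast
      ring
  have h5 : 5 ∣ m := by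
    have h1 := hcol m le_rfl
    rw [hm, p.getVert_length, ← hm] at h1
    have h2 : (2 : ZMod 5) * m = 0 := by simpa using h1.symm
    have h3 : (m : ZMod 5) = 0 := by
      calc (m : ZMod 5) = 3 * (2 * m) := by
            rw [← mul_assoc]
            exact (one_mul _).symm
        _ = 0 := by rw [h2, mul_zero]
    exact (ZMod.natCast_eq_zero_iff m 5).1 h3
  obtain ⟨h, hh⟩ := h5
  let x : ℕ → V := fun i => p.getVert (i % m)
  have hx : ∀ i, G.Adj (x i) (x (i + 1)) := p.adj_getVert_mod hp
  have hxc : ∀ i, c (x i) = c v + 2 * i := by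
    intro i
    rw [hcol _ (Nat.mod_lt _ hp).le]
    congr 2
    rw [ZMod.natCast_eq_natCast_iff]
    exact (Nat.mod_modEq i m).of_dvd ⟨h, hh⟩
  have hB : ∀ z, ((Finset.range m).filter fun j => G.Adj z (x j)).card ≤ h := by
    intro z
    set a : ZMod 5 := 3 * (c z - 2 - c v) with ha
    have hcls : ∀ j, G.Adj z (x j) → (j : ZMod 5) = a ∨ (j : ZMod 5) = a + 2 := by
      intro j hj
      have := hc _ _ hj
      rw [hxc] at this
      have key : ∀ j s t : ZMod 5, t + 2 * j - s = 2 ∨ s - (t + 2 * j) = 2 →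
          j = 3 * (s - 2 - t) ∨ j = 3 * (s - 2 - t) + 2 := by decide
      exact key _ _ _ this
    -- Neighbours of z on the walk have indices in the classes a and a + 2 modulo 5. Moving the
    -- second class forward by 3 lands in the first, injectively: z adjacent to both x j and x (j +
    -- 3) would give a closed 5-walk.
    let φ : ℕ → ℕ := fun j => if (j : ZMod 5) = a then j else (j + 3) % m
    have hφ : ∀ j, G.Adj z (x j) → (φ j : ZMod 5) = a := by
      intro j hj
      simp only [φ]
      split_ifs with h1
      · exact h1
      · have h2 : (((j + 3) % m : ℕ) : ZMod 5) = ((j + 3 : ℕ) : ZMod 5) := by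
          rw [ZMod.natCast_eq_natCast_iff]
          exact (Nat.mod_modEq _ m).of_dvd ⟨h, hh⟩
        rw [h2]
        push_cast
        rw [(hcls j hj).resolve_left h1, add_assoc]
        exact add_zero a
    have hclash : ∀ i j, G.Adj z (x i) → G.Adj z (x j) → i = (j + 3) % m → False := by
      intro i j hi hj hij
      have : x i = x (j + 3) := by
        simp only [x]
        rw [hij, Nat.mod_mod]
      exact hG.five _ _ _ _ _ hj (hx j) (hx _) (hx _) (this ▸ hi.symm)
    refine (Finset.card_le_card_of_injOn (t := Finset.range h) (fun j => φ j / 5) ?_ ?_).trans_eq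
      (Finset.card_range h)
    · intro j hj
      simp only [Finset.coe_filter, Finset.mem_range, Set.mem_ofPred_eq] at hj
      simp only [Finset.coe_range, Set.mem_Iio]
      refine Nat.div_lt_of_lt_mul ?_
      rw [← hh]
      simp only [φ]
      split_ifs
      · exact hj.1
      · exact Nat.mod_lt _ hp
    · intro i hi j hj hij
      simp only [Finset.coe_filter, Finset.mem_range, Set.mem_ofPred_eq] at hi hj
      have h1 : φ i = φ j := by
        have : φ i % 5 = φ j % 5 := by
          have := (hφ i hi.2).trans (hφ j hj.2).symm
          exact (ZMod.natCast_eq_natCast_iff _ _ _).1 this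
        have h2 : φ i / 5 = φ j / 5 := hij
        omega
      simp only [φ] at h1
      split_ifs at h1
      · exact h1
      · exact (hclash _ _ hi.2 hj.2 h1).elim
      · exact (hclash _ _ hj.2 hi.2 h1.symm).elim
      · exact Nat.ModEq.eq_of_lt_of_lt (Nat.ModEq.add_right_cancel' 3 h1) hi.1 hj.1
  have := mul_lt_of_card_le hdeg hp x hB
  rw [hh] at this
  have h2 : (5 * k - 3) * h ≤ k * (5 * h) := by
    calc (5 * k - 3) * h ≤ (5 * k) * h := Nat.mul_le_mul_right _ (by omega)
      _ = _ := by ring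
  omega

end

end SimpleGraph

/-! ### Closed walks with the fewest backward steps -/

namespace SimpleGraph

variable {V : Type*} {G : SimpleGraph V} [Fintype V] [DecidableRel G.Adj] {k : ℕ}

/-- The arithmetic that rules out a closed walk with few backward steps. -/
theorem progression_bound {k p q : ℕ} (hk : 2 ≤ k) (h : k * p < (5 * k - 3) * (p - 2 * q + 1))
    (hpq : 2 * p < 5 * q) (hN : (5 * k - 8) * (5 * q - 2 * p) < p) : False := by
  obtain ⟨t, ht⟩ : ∃ t, 5 * q = 2 * p + (t + 1) := ⟨5 * q - 2 * p - 1, by omega⟩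
  rw [show 5 * q - 2 * p = t + 1 by omega] at hN
  obtain ⟨k, rfl⟩ : ∃ l, k = l + 2 := ⟨k - 2, by omega⟩
  rw [show 5 * (k + 2) - 8 = 5 * k + 2 by omega] at hN
  rw [show 5 * (k + 2) - 3 = 5 * k + 7 by omega] at h
  have h2 : 2 * q ≤ p := by nlinarith
  obtain ⟨r, hr⟩ : ∃ r, p = 2 * q + r := ⟨p - 2 * q, by omega⟩
  rw [show p - 2 * q + 1 = r + 1 by omega] at h
  have h5 : 5 * r + 2 * (t + 1) = p := by omega
  have h6 : 3 * p + (5 * k + 7) * (2 * (t + 1)) < (5 * k + 7) * 5 := by nlinarith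
  -- For t = 0, p is 2 modulo 5 but lies strictly between the consecutive such numbers 5k + 2 and 5k
  -- + 7. For t = 1 the two bounds on p contradict each other, and for t ≥ 2 the last inequality
  -- fails by itself.
  rcases Nat.lt_or_ge t 2 with ht2 | ht2
  · interval_cases t <;> omega
  · nlinarith

/-- Every closed walk has many backward steps. -/
theorem gain_nonpos (hG : G.NoClosed35) (hk : 2 ≤ k)
    (hdeg : ∀ v, k * Fintype.card V < (5 * k - 3) * G.degree v) {c : V → ZMod 5}
    (hc : ∀ a b, G.Adj a b → c b - c a = 2 ∨ c a - c b = 2) {v₀ : V} (p₀ : G.Walk v₀ v₀)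
    (hp₀ : p₀.length ≤ Fintype.card V) : p₀.gain (stepWeight c 1 (5 * k - 9)) ≤ 0 := by
  by_contra! hpos
  have hneg {v : V} (p : G.Walk v v) (hp : 0 < p.length) : p.gain (stepWeight c 0 1) < 0 :=
    gain_neg hG hk hdeg hc p hp
  -- Pairs of length and number of backward steps. The bound on the length makes the set finite, so
  -- the ratio attains a maximum.
  let T : Set (ℕ × ℕ) := {r | ∃ (v : V) (p : G.Walk v v), 0 < p.length ∧
    p.length ≤ Fintype.card V ∧ r.1 = p.length ∧ (r.2 : ℤ) = -p.gain (stepWeight c 0 1)}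
  have hT : T.Finite := by
    refine ((Finset.range (Fintype.card V + 1)) ×ˢ
      (Finset.range (Fintype.card V + 1))).finite_toSet.subset ?_
    rintro ⟨m, b⟩ ⟨v, p, h1, h2, h3, h4⟩
    have := (p.gain_stepWeight_nonpos c).2
    simp only [Finset.coe_product, Set.mem_prod, Finset.coe_range, Set.mem_Iio]
    dsimp only at h3 h4
    omega
  have hmemT {v : V} (p : G.Walk v v) (h : 0 < p.length) (h' : p.length ≤ Fintype.card V) :
      (p.length, (-p.gain (stepWeight c 0 1)).toNat) ∈ T :=
    ⟨v, p, h, h', rfl, by have := hneg p h; dsimp only; omega⟩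
  rw [Walk.gain_stepWeight] at hpos
  have hp₀' : 0 < p₀.length := by
    have := (p₀.gain_stepWeight_nonpos c).1
    by_contra h0
    have h0 : p₀.length = 0 := by omega
    rw [h0] at hpos
    push_cast at hpos
    nlinarith
  obtain ⟨⟨m, b⟩, hmb, hmax⟩ := Set.exists_max_image T (fun r => (r.1 : ℚ) / r.2) hT
    ⟨_, hmemT p₀ hp₀' hp₀⟩
  obtain ⟨v, p, hm0, hmn, hm, hb⟩ := hmb
  dsimp only at hm hb
  have hb0 : 0 < b := by have := hneg p hm0; omega
  have hle {v : V} (p : G.Walk v v) (h : 0 < p.length) (h' : p.length ≤ Fintype.card V) :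
      b * p.length + m * p.gain (stepWeight c 0 1) ≤ (0 : ℤ) := by
    have h1 := hmax _ (hmemT p h h')
    dsimp only at h1
    have h2 := hneg p h
    obtain ⟨d, hd⟩ : ∃ d : ℕ, p.gain (stepWeight c 0 1) = -d :=
      ⟨(-p.gain (stepWeight c 0 1)).toNat, by omega⟩
    rw [hd] at h1 h2 ⊢
    rw [neg_neg, Int.toNat_natCast, div_le_div_iff₀ (by norm_cast; omega) (by exact_mod_cast hb0)]
      at h1
    have h3 : p.length * b ≤ m * d := by exact_mod_cast h1
    zify at h3
    linarith
  have hN : ((5 * k - 8 : ℕ) : ℤ) * b < m := by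
    have h1 := hle p₀ hp₀' hp₀
    have h2 := hneg p₀ hp₀'
    push_cast [show 8 ≤ 5 * k by omega]
    have h3 : (b : ℤ) * (((5 * k - 8 : ℤ)) * -p₀.gain (stepWeight c 0 1)) <
        b * p₀.length := mul_lt_mul_of_pos_left (by linarith) (by exact_mod_cast hb0)
    have h4 : (5 * k - 8 : ℤ) * b * -p₀.gain (stepWeight c 0 1) <
        m * -p₀.gain (stepWeight c 0 1) := by linarith
    exact lt_of_mul_lt_mul_right h4 (by linarith)
  -- With these weights the gain of a closed walk is b times its length minus m times its number of
  -- backward steps. This is at most 0 by the maximality of m/b, with equality for `p`, so every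
  -- step of `p` is tight.
  obtain ⟨Θ, hΘ⟩ := exists_potential (G := G) (w := stepWeight c b (m - b)) (by
    intro v p hp
    rw [Walk.gain_stepWeight]
    rcases Nat.eq_zero_or_pos p.length with h0 | h0
    · have := p.gain_stepWeight_nonpos c
      rw [h0] at this ⊢
      have : p.gain (stepWeight c 0 1) = 0 := by omega
      simp [this]
    · have := hle p h0 hp
      linarith)
  have htight : ∀ i < m, Θ (p.getVert i) + stepWeight c b (m - b) (p.getVert i)
      (p.getVert (i + 1)) = Θ (p.getVert (i + 1)) := by
    intro i hi
    refine p.tight_of_add_gain_eq hΘ ?_ (hm ▸ hi)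
    rw [Walk.gain_stepWeight, ← hm, show p.gain (stepWeight c 0 1) = -b by omega]
    ring
  let P : V → ℤ := fun a => m * (c a).val + Θ a
  -- A forward step advances the position by 2m + b and a backward step by -3m + b, which agree
  -- modulo 5m.
  have hP : ∀ i ≤ m, ∃ t : ℤ, P (p.getVert i) = P v + i * (2 * m + b) + 5 * m * t := by
    intro i
    induction i with
    | zero => exact fun _ => ⟨0, by simp⟩
    | succ i ih =>
      intro hi
      obtain ⟨t, ht⟩ := ih (by omega)
      have h1 := htight i (by omega)
      have h2 : G.Adj (p.getVert i) (p.getVert (i + 1)) := p.adj_getVert_succ (by omega)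
      rw [stepWeight] at h1
      simp only [P] at ht ⊢
      push_cast
      split_ifs at h1 with h3
      · rcases val_sub_eq_two h3 with h4 | h4
        · exact ⟨t, by rw [h4, ← h1]; linear_combination ht⟩
        · exact ⟨t - 1, by rw [h4, ← h1]; linear_combination ht⟩
      · rcases val_sub_eq_two ((hc _ _ h2).resolve_left h3) with h4 | h4
        · exact ⟨t - 1, by rw [← h1]; linear_combination ht - m * h4⟩
        · exact ⟨t, by rw [← h1]; linear_combination ht - m * h4⟩
  have hnbr : ∀ z y, G.Adj z y → ∃ t : ℤ, 2 * m + b ≤ P y - P z + 5 * m * t ∧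
      P y - P z + 5 * m * t ≤ 3 * m - b := by
    intro z y hzy
    have h1 := hΘ _ _ hzy
    have h2 := hΘ _ _ hzy.symm
    have h22 : ∀ s t : ZMod 5, t - s = 2 → s - t ≠ 2 := by decide
    simp only [P]
    rcases hc _ _ hzy with h3 | h3
    · rw [stepWeight, if_pos h3] at h1
      rw [stepWeight, if_neg (h22 _ _ h3)] at h2
      rcases val_sub_eq_two h3 with h4 | h4
      · exact ⟨0, by rw [h4]; constructor <;> linarith⟩
      · exact ⟨1, by rw [h4]; constructor <;> linarith⟩
    · rw [stepWeight, if_neg (h22 _ _ h3)] at h1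
      rw [stepWeight, if_pos h3] at h2
      rcases val_sub_eq_two h3 with h4 | h4
      · exact ⟨1, by rw [h4]; constructor <;> linarith⟩
      · exact ⟨0, by rw [h4]; constructor <;> linarith⟩
  -- As the walk closes after m steps, m(2m + b) is a multiple of 5m, whence 5 divides 2m + b.
  have hm0' : 0 < m := by omega
  obtain ⟨q, hq⟩ : ∃ q, 2 * m + b = 5 * q := by
    obtain ⟨t, ht⟩ := hP m le_rfl
    rw [hm, p.getVert_length, ← hm] at ht
    have h1 : (m : ℤ) * (2 * m + b + 5 * t) = 0 := by linear_combination -ht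
    have h2 := (mul_eq_zero.1 h1).resolve_left (by omega)
    exact ⟨(-t).toNat, by omega⟩
  obtain ⟨g, r, s, hg, hrs, hmr, hqs⟩ := Nat.exists_coprime' (m := m) (n := q)
    (Nat.gcd_pos_of_pos_left _ hm0')
  have hbN : (5 * k - 8) * b < m := by exact_mod_cast hN
  have hb2 : 2 * b ≤ m := by nlinarith [show 2 ≤ 5 * k - 8 by omega]
  have hs2 : 2 * s ≤ r := by
    have : 2 * q ≤ m := by omega
    rw [hmr, hqs, ← mul_assoc] at this
    exact Nat.le_of_mul_le_mul_right this hg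
  have hs0 : 0 < s := by
    rcases Nat.eq_zero_or_pos s with h | h
    · rw [h] at hqs
      omega
    · exact h
  -- Neighbours of z lie at positions between 2m + b = 5gs and 3m - b = 5g(r - s) after that of z,
  -- and the walk is a progression with difference 5gs modulo 5gr.
  have hcard : ∀ z, ((Finset.range m).filter fun j => G.Adj z (p.getVert j)).card ≤
      (r - 2 * s + 1) * g := by
    intro z
    refine card_le_of_progression hg hs0 hrs hs2 (P v - P z) ?_ fun j hj => ?_
    · rw [mul_comm g, ← hmr]
      exact Finset.filter_subset _ _
    · rw [Finset.mem_filter, Finset.mem_range] at hj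
      obtain ⟨t, ht⟩ := hP j hj.1.le
      obtain ⟨t', h1, h2⟩ := hnbr _ _ hj.2
      rw [ht] at h1 h2
      have e1 : (2 * m + b : ℤ) = 5 * (s * g) := by
        rw [← Nat.cast_mul, ← hqs]
        exact_mod_cast hq
      have e2 : (m : ℤ) = r * g := by exact_mod_cast hmr
      have e3 : P v - P z + 5 * g * s * j + 5 * g * r * (t + t') =
          P v + j * (2 * m + b) + 5 * m * t - P z + 5 * m * t' := by
        rw [e1, e2]
        ring
      refine ⟨t + t', ?_, ?_⟩
      · rw [e3]
        linarith
      · rw [e3]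
        linarith
  have hfin := mul_lt_of_card_le hdeg hm0' _ hcard
  refine progression_bound (p := r) (q := s) hk ?_ ?_ ?_
  · rw [hmr] at hfin
    refine Nat.lt_of_mul_lt_mul_right (a := g) ?_
    calc k * r * g = k * (r * g) := by ring
      _ < _ := hfin
      _ = _ := by ring
  · refine Nat.lt_of_mul_lt_mul_right (a := g) ?_
    rw [mul_assoc, mul_assoc, ← hmr, ← hqs]
    omega
  · refine Nat.lt_of_mul_lt_mul_right (a := g) ?_
    rw [mul_assoc, ← hmr]
    rwa [show (5 * s - 2 * r) * g = b by
      rw [Nat.sub_mul, mul_assoc, mul_assoc, ← hmr, ← hqs]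
      omega]

end SimpleGraph

theorem mainTheorem4 {V : Type*} [Fintype V] (G : SimpleGraph V) [DecidableRel G.Adj]
    (k : ℕ) (hk : 2 ≤ k) (hfree : IsC3C5Free G)
    (hdeg : (k : ℝ) / (5 * (k : ℝ) - 3) * (Fintype.card V : ℝ) < (G.minDegree : ℝ)) :
    IsHomomorphicTo G (andrasfaiF (k - 1)) := by
  classical
  have hk' : (2 : ℝ) ≤ k := by exact_mod_cast hk
  have hdeg₁ : ∀ v, k * Fintype.card V < (5 * k - 3) * G.degree v := by
    intro v
    have h1 : (G.minDegree : ℝ) ≤ G.degree v := by exact_mod_cast G.minDegree_le_degree v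
    rw [div_mul_eq_mul_div, div_lt_iff₀ (by linarith)] at hdeg
    have h2 : (k : ℝ) * Fintype.card V < (5 * k - 3) * G.degree v := by nlinarith
    have h3 : ((5 * k - 3 : ℕ) : ℝ) = 5 * k - 3 := by
      push_cast [show 3 ≤ 5 * k by omega]
      ring
    rw [← h3] at h2
    exact_mod_cast h2
  have hdeg₂ : ∀ v, Fintype.card V < 5 * G.degree v := by
    intro v
    have h1 := hdeg₁ v
    have h2 : (5 * k - 3) * G.degree v ≤ k * (5 * G.degree v) := by
      calc (5 * k - 3) * G.degree v ≤ (5 * k) * G.degree v := Nat.mul_le_mul_right _ (by omega)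
        _ = _ := by ring
    exact Nat.lt_of_mul_lt_mul_left (h1.trans_le h2)
  have hG := SimpleGraph.noClosed35_of_isC3C5Free hfree
  -- The enlarged graph only supplies the colouring, which restricts to `G`; the lift is carried out
  -- in `G`.
  obtain ⟨G', hle, hG', h4⟩ := hG.exists_le_fourConnected fun v => by
    rw [← G.degree_pos_iff_exists_adj]
    have := hdeg₂ v
    omega
  obtain ⟨c, hc⟩ := SimpleGraph.exists_pentagon_coloring hG' h4 fun v =>
    (hdeg₂ v).trans_le (Nat.mul_le_mul_left _ (SimpleGraph.degree_le_of_le hle))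
  have hc' : ∀ a b, G.Adj a b → c b - c a = 2 ∨ c a - c b = 2 := fun a b h => hc a b (hle h)
  exact SimpleGraph.isHomomorphicTo_of_nonpos hk hc' fun v p hp =>
    SimpleGraph.gain_nonpos hG hk hdeg₁ hc' p hp
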